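/- Let $G=(V,E)$ be a finite simple graph whose nodes are agents, and let $b_i$ be a positive integer (the peak) for each $i\in V$. A $b$-matching is a family of nonnegative integers $x_{ij}=x_{ji}$ ($i,j\in V$), with $x_{ij}=0$ unless $ij\in E$, such that $\sum_j x_{ij}\le b_i$ for all $i$; its utility profile is $(\sum_j x_{ij})_{i\in V}$, and it is maximum if the sum of the utilities is largest possible. A lottery over maximum $b$-matchings is a probability distribution on the set of maximum $b$-matchings; its utility profile is the expected utility profile. Let $V^U$ be the set of agents $i$ whose utility is less than $b_i$ in at least one maximum $b$-matching, $V^O$ the set of agents outside $V^U$ with a neighbour in $V^U$, and $V^P=V\setminus(V^U\cup V^O)$. Let $\mathcal C$ be the set of connected components of the subgraph induced by $V^U$ (the odd components). The modified bipartite network has a source $s$, a sink $t$, and * a left node $a_i$ for each $i\in V$, with an arc $s\to a_i$ of capacity $b_i$; * a right node $c_i$ for each $i\in V^P\cup V^O$, with an arc $c_i\to t$ of capacity $b_i$ and an uncapacitated arc $a_i\to c_i$; * a right node $c'_j$ for each $j\in V^O$, with an arc $c'_j\to t$ of capacity $b_j$ and an uncapacitated arc $a_i\to c'_j$ for each $i\in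 V^U$ with $ij\in E$; * a right node for each $C\in\mathcal C$ with $|C|\ge 2$, with an arc to $t$ of capacity $\sum_{i\in C}b_i-1$ and an uncapacitated arc from $a_i$ for each $i\in C$. The utility profile of a flow is the vector of its values on the arcs $s\to a_i$, $i\in V$. **Lemma.** (1) A vector $U\in\mathbb R^V$ is the utility profile of an integral maximum $s$–$t$ flow in the modified network if and only if it is the utility profile of a maximum $b$-matching of $G$. (2) A vector $U\in\mathbb R^V$ is the utility profile of a (real-valued) maximum $s$–$t$ flow in the modified network if and only if it is the utility profile of a lottery over maximum $b$-matchings of $G$. -/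

import Mathlib

/-- A (finite, uncapacitated, integral) `b`-matching of the network `G` with peaks `b`:
`exch i j` is the number of units of the indivisible good exchanged by `i` and `j`. -/
structure BMatching {V : Type*} [Fintype V] (G : SimpleGraph V) (b : V → ℕ) where
  exch : V → V → ℕ
  exch_symm : ∀ i j, exch i j = exch j i
  exch_eq_zero : ∀ i j, ¬ G.Adj i j → exch i j = 0
  sum_exch_le : ∀ i, ∑ j, exch i j ≤ b i

namespace BMatching

variable {V : Type*} [Fintype V] {G : SimpleGraph V} {b : V → ℕ}

/-- The utility of agent `i`: the total number of units that `i` exchanges. -/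
def utility (μ : BMatching G b) (i : V) : ℕ := ∑ j, μ.exch i j

/-- A maximum `b`-matching maximizes the sum of the utilities (twice the size). -/
def IsMaximum (μ : BMatching G b) : Prop :=
  ∀ ν : BMatching G b, ∑ i, ν.utility i ≤ ∑ i, μ.utility i

end BMatching

/-- A lottery over the maximum `b`-matchings of `(G, b)`.  (There are only finitely many
`b`-matchings, so finite support is no restriction.) -/
structure MatchingLottery {V : Type*} [Fintype V] (G : SimpleGraph V) (b : V → ℕ) where
  prob : BMatching G b →₀ ℝ
  prob_nonneg : ∀ μ, 0 ≤ prob μ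
  sum_prob : (prob.sum fun _ p => p) = 1
  isMaximum_of_mem_support : ∀ μ ∈ prob.support, μ.IsMaximum

/-- The expected utility of agent `i` under a lottery. -/
noncomputable def MatchingLottery.utility {V : Type*} [Fintype V] {G : SimpleGraph V}
    {b : V → ℕ} (l : MatchingLottery G b) (i : V) : ℝ :=
  l.prob.sum fun μ p => p * (μ.utility i : ℝ)

section GallaiEdmonds

variable {V : Type*} [Fintype V] (G : SimpleGraph V) (b : V → ℕ)

/-- `V^U`: the agents that are unsaturated in at least one maximum `b`-matching. -/
def underDemanded : Set V :=
  {i | ∃ μ : BMatching G b, μ.IsMaximum ∧ μ.utility i < b i}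

/-- `V^O`: the agents outside `V^U` that have a neighbour in `V^U`. -/
def overDemanded : Set V :=
  {i | i ∉ underDemanded G b ∧ ∃ j ∈ underDemanded G b, G.Adj i j}

/-- `V^P`: all other agents. -/
def perfectlyDemanded : Set V :=
  {i | i ∉ underDemanded G b ∧ i ∉ overDemanded G b}

/-- The odd components of the decomposition: the connected components of the subnetwork
induced by `V^U`. -/
abbrev OddComponent : Type _ :=
  (G.induce (underDemanded G b)).ConnectedComponent

variable {G b} in
/-- The set of agents of an odd component, as a subset of `V`. -/
def OddComponent.agents (C : OddComponent G b) : Set V :=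
  Subtype.val '' C.supp

open Classical in
variable {G b} in
/-- The sum of the peaks of the agents of an odd component. -/
noncomputable def OddComponent.peakSum (C : OddComponent G b) : ℕ :=
  ∑ i with i ∈ OddComponent.agents C, b i

/-- The right-hand side of the modified bipartite network. -/
inductive RightNode : Type _
  /-- the node `c_i`, for `i` in `V^P ∪ V^O` -/
  | own (i : {i : V // i ∈ perfectlyDemanded G b ∪ overDemanded G b})
  /-- the node `c'_j`, for `j` in `V^O` -/
  | over (j : {j : V // j ∈ overDemanded G b})
  /-- the node of `B^C`, for an odd component `C` with at least two agents -/
  | comp (C : {C : OddComponent G b // 2 ≤ (OddComponent.agents C).ncard})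

instance : Finite (RightNode G b) := by
  classical
  let f : ({i : V // i ∈ perfectlyDemanded G b ∪ overDemanded G b} ⊕
      {j : V // j ∈ overDemanded G b}) ⊕
      {C : OddComponent G b // 2 ≤ (OddComponent.agents C).ncard} → RightNode G b :=
    Sum.elim (Sum.elim RightNode.own RightNode.over) RightNode.comp
  refine Finite.of_surjective f ?_
  rintro (i | j | C)
  · exact ⟨Sum.inl (Sum.inl i), rfl⟩
  · exact ⟨Sum.inl (Sum.inr j), rfl⟩
  · exact ⟨Sum.inr C, rfl⟩

noncomputable instance : Fintype (RightNode G b) := Fintype.ofFinite _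

end GallaiEdmonds

/-- A bipartite flow network with a source `s` and a sink `t`: an arc `s → a` of capacity
`leftCap a` for each `a : A`, an uncapacitated arc `a → c` for each pair with `arc a c`,
and an arc `c → t` of capacity `rightCap c` for each `c : B`. -/
structure BipartiteNetwork (A B : Type*) where
  arc : A → B → Prop
  leftCap : A → ℕ
  rightCap : B → ℕ

namespace BipartiteNetwork

variable {A B : Type*} [Fintype A] [Fintype B]

/-- A feasible (real-valued) flow from the source to the sink. -/
structure Flow (N : BipartiteNetwork A B) where
  /-- the flow on the arc `s → a` -/
  fromSource : A → ℝ
  /-- the flow on the arc `a → c` -/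
  across : A → B → ℝ
  /-- the flow on the arc `c → t` -/
  toSink : B → ℝ
  fromSource_nonneg : ∀ a, 0 ≤ fromSource a
  fromSource_le : ∀ a, fromSource a ≤ N.leftCap a
  across_nonneg : ∀ a c, 0 ≤ across a c
  across_eq_zero : ∀ a c, ¬ N.arc a c → across a c = 0
  toSink_nonneg : ∀ c, 0 ≤ toSink c
  toSink_le : ∀ c, toSink c ≤ N.rightCap c
  conservation_left : ∀ a, fromSource a = ∑ c, across a c
  conservation_right : ∀ c, ∑ a, across a c = toSink c

variable {N : BipartiteNetwork A B}

/-- The value of a flow: the total amount leaving the source. -/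
noncomputable def Flow.value (φ : N.Flow) : ℝ := ∑ a, φ.fromSource a

/-- Maximum flows: maximal value among all feasible real-valued flows. -/
def Flow.IsMaximum (φ : N.Flow) : Prop := ∀ ψ : N.Flow, ψ.value ≤ φ.value

/-- A flow is integral if its value on every arc is an integer. -/
def Flow.IsIntegral (φ : N.Flow) : Prop :=
  (∀ a, ∃ n : ℤ, φ.fromSource a = n) ∧ (∀ a c, ∃ n : ℤ, φ.across a c = n) ∧
    ∀ c, ∃ n : ℤ, φ.toSink c = n

end BipartiteNetwork

/-- The modified bipartite network.  The left-hand side has a node `a_i` of capacity `b i`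
for each agent `i`. -/
noncomputable def modifiedNetwork {V : Type*} [Fintype V] (G : SimpleGraph V) (b : V → ℕ) :
    BipartiteNetwork V (RightNode G b) where
  arc i c := match c with
    | .own j => i = j.1
    | .over j => i ∈ underDemanded G b ∧ G.Adj i j.1
    | .comp C => i ∈ OddComponent.agents C.1
  leftCap i := b i
  rightCap c := match c with
    | .own j => b j.1
    | .over j => b j.1
    | .comp C => OddComponent.peakSum C.1 - 1

/-! The result rests on a Gallai–Edmonds structure theorem for b-matchings. Every maximum b-matching
saturates V^O and V^P, lets V^O trade only with V^U, and creates exactly `peakSum C - 1` units of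
utility inside each odd component C with at least two agents (`sum_sum_exch_agents`). Read as a
flow, such a matching therefore fills every sink arc, and the maximum flows are exactly those that
fill all sink arcs. Conversely, an integral flow of this kind prescribes the trades between V^U and
V^O, and on each large component it prescribes the peaks minus one unit at some agent. Criticality
(`exists_core_deficit`) realises every such profile, V^P is served by trades within itself, and the
pieces are glued in `exists_isMaximum_of_sums`.

The structure theorem comes from moving one matching towards another unit by unit, with descent on
`excess` (`exists_partner_or_reroute`), in place of alternating paths. This yields Gallai's lemma
(`not_misses_trans`) and the stability lemma (`mem_underDemanded_of_misses`). By stability, each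
unit of peak removed from V^O lowers the maximum total by exactly 2 and leaves V^U unchanged. Once
V^O is shut down (the "core"), the components of V^U are isolated. By Gallai's lemma a large
component misses at most one unit, and by parity exactly one.

For lotteries, a Birkhoff decomposition writes a maximum flow as a convex combination of integral
maximum flows; in the other direction the flows of the matchings in the support are averaged. -/

namespace BMatching

/-! ### Moving single units of exchange. -/

section Exchange

open Classical in
/-- The indicator of the agent `x`, as a natural number. -/
noncomputable def ind {V : Type*} (x i : V) : ℕ := if i = x then 1 else 0

/-- One unit exchanged between `x` and `y`. -/
noncomputable def edgeUnit {V : Type*} (x y i j : V) : ℕ := ind x i * ind y j + ind y i * ind x j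

section

variable {V : Type*}

@[simp] theorem ind_self (x : V) : ind x x = 1 := by simp [ind]

theorem ind_of_ne {x i : V} (h : i ≠ x) : ind x i = 0 := by simp [ind, h]

@[simp] theorem sum_ind [Fintype V] (x : V) : ∑ i, ind x i = 1 := by
  classical
  simp [ind, Finset.sum_ite_eq']

theorem edgeUnit_comm (x y i j : V) : edgeUnit x y i j = edgeUnit x y j i := by
  unfold edgeUnit; ring

theorem sum_edgeUnit [Fintype V] (x y i : V) : ∑ j, edgeUnit x y i j = ind x i + ind y i := by
  simp [edgeUnit, Finset.sum_add_distrib, ← Finset.mul_sum]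

/-- Distinctness matters: for `x = y` the diagonal entry would be 2. -/
theorem edgeUnit_cases {x y : V} (h : x ≠ y) (i j : V) :
    (i = x ∧ j = y ∨ i = y ∧ j = x) ∧ edgeUnit x y i j = 1 ∨
      ¬ (i = x ∧ j = y ∨ i = y ∧ j = x) ∧ edgeUnit x y i j = 0 := by
  unfold edgeUnit ind
  by_cases h1 : i = x <;> by_cases h2 : j = y <;> by_cases h3 : i = y <;> by_cases h4 : j = x <;>
    simp_all

/-- Modulo 2 the terms at (i, j) and (j, i) cancel and the diagonal vanishes. This gives both the
parity of totals and the oddness of the components. -/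
theorem even_sum_of_symm (s : Finset V) (x : V → V → ℕ) (hs : ∀ i j, x i j = x j i)
    (h0 : ∀ i, x i i = 0) : Even (∑ i ∈ s, ∑ j ∈ s, x i j) := by
  rw [← ZMod.natCast_eq_zero_iff_even, ← Finset.sum_product']
  push_cast
  refine Finset.sum_involution (fun p _ => p.swap) ?_ ?_ ?_ ?_
  · rintro ⟨i, j⟩ _
    simp only [Prod.fst_swap, Prod.snd_swap]
    rw [hs j i]
    exact CharTwo.add_self_eq_zero _
  · rintro ⟨i, j⟩ _ hne heq
    simp only [Prod.swap_prod_mk, Prod.mk.injEq] at heq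
    obtain ⟨rfl, -⟩ := heq
    simp [h0] at hne
  · rintro ⟨i, j⟩ h
    simpa [and_comm] using h
  · simp

end

variable {V : Type*} [Fintype V] {G : SimpleGraph V} {b : V → ℕ}

/-- The sum of the utilities of all agents. -/
def total (μ : BMatching G b) : ℕ := ∑ i, μ.utility i

theorem utility_le (μ : BMatching G b) (i : V) : μ.utility i ≤ b i := μ.sum_exch_le i

theorem adj_of_exch_pos (μ : BMatching G b) {i j : V} (h : 0 < μ.exch i j) : G.Adj i j := by
  by_contra hn
  rw [μ.exch_eq_zero i j hn] at h
  exact absurd h (lt_irrefl 0)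

theorem exch_self (μ : BMatching G b) (i : V) : μ.exch i i = 0 :=
  μ.exch_eq_zero i i (G.loopless.irrefl i)

theorem even_total (μ : BMatching G b) : Even μ.total :=
  even_sum_of_symm Finset.univ μ.exch μ.exch_symm μ.exch_self

/-- A matching of `(G, b)` that respects other peaks `c`, as a matching of `(G, c)`. -/
def ofLE (μ : BMatching G b) (c : V → ℕ) (h : ∀ i, μ.utility i ≤ c i) : BMatching G c where
  exch := μ.exch
  exch_symm := μ.exch_symm
  exch_eq_zero := μ.exch_eq_zero
  sum_exch_le := h

/-- Adding one unit to the exchange between `x` and `y`. -/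
noncomputable def addEdge (μ : BMatching G b) {x y : V} (h : G.Adj x y) (c : V → ℕ)
    (hc : ∀ i, μ.utility i + ind x i + ind y i ≤ c i) : BMatching G c where
  exch i j := μ.exch i j + edgeUnit x y i j
  exch_symm i j := by rw [μ.exch_symm, edgeUnit_comm]
  exch_eq_zero i j hn := by
    rw [μ.exch_eq_zero i j hn, zero_add]
    obtain ⟨⟨rfl, rfl⟩ | ⟨rfl, rfl⟩, -⟩ | ⟨-, h0⟩ := edgeUnit_cases h.ne i j
    · exact absurd h hn
    · exact absurd h.symm hn
    · exact h0
  sum_exch_le i := by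
    rw [Finset.sum_add_distrib, sum_edgeUnit, ← add_assoc]
    exact hc i

theorem utility_addEdge (μ : BMatching G b) {x y : V} (h : G.Adj x y) (c : V → ℕ)
    (hc : ∀ i, μ.utility i + ind x i + ind y i ≤ c i) (i : V) :
    (μ.addEdge h c hc).utility i = μ.utility i + ind x i + ind y i := by
  unfold utility addEdge
  rw [Finset.sum_add_distrib, sum_edgeUnit, ← add_assoc]

theorem total_addEdge (μ : BMatching G b) {x y : V} (h : G.Adj x y) (c : V → ℕ)
    (hc : ∀ i, μ.utility i + ind x i + ind y i ≤ c i) :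
    (μ.addEdge h c hc).total = μ.total + 2 := by
  simp [total, utility_addEdge, Finset.sum_add_distrib, add_assoc]

theorem edgeUnit_le_exch (μ : BMatching G b) {x y : V} (h : 0 < μ.exch x y) (i j : V) :
    edgeUnit x y i j ≤ μ.exch i j := by
  obtain ⟨⟨rfl, rfl⟩ | ⟨rfl, rfl⟩, h1⟩ | ⟨-, h0⟩ :=
    edgeUnit_cases (μ.adj_of_exch_pos h).ne i j
  · rw [h1]; exact h
  · rw [h1, μ.exch_symm]; exact h
  · rw [h0]; exact Nat.zero_le _

theorem sum_exch_sub_edgeUnit (μ : BMatching G b) {x y : V} (h : 0 < μ.exch x y) (i : V) :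
    ∑ j, (μ.exch i j - edgeUnit x y i j) + ind x i + ind y i = μ.utility i := by
  rw [add_assoc, ← sum_edgeUnit, ← Finset.sum_add_distrib]
  exact Finset.sum_congr rfl fun j _ => Nat.sub_add_cancel (μ.edgeUnit_le_exch h i j)

/-- Removing one unit from the exchange between `x` and `y`. -/
noncomputable def removeEdge (μ : BMatching G b) {x y : V} (h : 0 < μ.exch x y) (c : V → ℕ)
    (hc : ∀ i, μ.utility i ≤ c i + ind x i + ind y i) : BMatching G c where
  exch i j := μ.exch i j - edgeUnit x y i j
  exch_symm i j := by rw [μ.exch_symm, edgeUnit_comm]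
  exch_eq_zero i j hn := by rw [μ.exch_eq_zero i j hn, Nat.zero_sub]
  sum_exch_le i := by
    have := μ.sum_exch_sub_edgeUnit h i
    have := hc i
    omega

theorem utility_removeEdge (μ : BMatching G b) {x y : V} (h : 0 < μ.exch x y) (c : V → ℕ)
    (hc : ∀ i, μ.utility i ≤ c i + ind x i + ind y i) (i : V) :
    (μ.removeEdge h c hc).utility i + ind x i + ind y i = μ.utility i :=
  μ.sum_exch_sub_edgeUnit h i

theorem total_removeEdge (μ : BMatching G b) {x y : V} (h : 0 < μ.exch x y) (c : V → ℕ)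
    (hc : ∀ i, μ.utility i ≤ c i + ind x i + ind y i) :
    (μ.removeEdge h c hc).total + 2 = μ.total := by
  simp [total, ← utility_removeEdge μ h c hc, Finset.sum_add_distrib, add_assoc]

/-- The amount by which the exchanges of `μ` exceed those of `ν`. -/
def excess (μ ν : BMatching G b) : ℕ := ∑ i, ∑ j, (μ.exch i j - ν.exch i j)

/-- If `x` is better off in `μ` than in `ν`, then `ν` can be moved towards `μ` by one unit at `x`:
either a partner of `x` has spare capacity, or `ν` can be rerouted without changing its total. -/
theorem exists_partner_or_reroute (μ ν : BMatching G b) {x : V}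
    (hx : ν.utility x < μ.utility x) :
    (∃ y, G.Adj x y ∧ ν.utility y < b y) ∨
      ∃ ν' : BMatching G b, ν'.total = ν.total ∧
        (∀ i, ν'.utility i ≤ ν.utility i + ind x i) ∧ excess μ ν' < excess μ ν := by
  obtain ⟨y, -, hy⟩ := Finset.exists_lt_of_sum_lt hx
  have hadj : G.Adj x y := μ.adj_of_exch_pos (by omega)
  by_cases hyb : ν.utility y < b y
  · exact Or.inl ⟨y, hadj, hyb⟩
  right
  have hle : ∑ z, μ.exch y z ≤ ∑ z, ν.exch y z := by
    have h1 := μ.utility_le y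
    have h2 : b y ≤ ν.utility y := not_lt.mp hyb
    exact h1.trans h2
  -- `y` is saturated in `ν` yet deals less with `x` there than in `μ`, so it must deal more with
  -- someone else. That unit is redirected to `x`.
  obtain ⟨z, hz⟩ : ∃ z, μ.exch y z < ν.exch y z := by
    by_contra! hcon
    refine absurd hle (not_le.mpr (Finset.sum_lt_sum (fun z _ => hcon z) ⟨x, Finset.mem_univ _, ?_⟩))
    rw [μ.exch_symm, ν.exch_symm]
    exact hy
  have hz0 : 0 < ν.exch y z := by omega
  have hyz : y ≠ z := (ν.adj_of_exch_pos hz0).ne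
  have hxz : x ≠ z := by
    rintro rfl
    rw [μ.exch_symm, ν.exch_symm] at hz
    omega
  have hc : ∀ i, ν.utility i ≤ b i + ind y i + ind z i := fun i => by
    have := ν.utility_le i
    omega
  set ρ := ν.removeEdge hz0 b hc with hρ
  have hρu : ∀ i, ρ.utility i + ind y i + ind z i = ν.utility i := ν.utility_removeEdge hz0 b hc
  have hxb := μ.utility_le x
  have hc' : ∀ i, ρ.utility i + ind x i + ind y i ≤ b i := fun i => by
    have h1 := hρu i
    have h2 := ν.utility_le i
    by_cases hix : i = x
    · subst hix
      rw [ind_self]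
      omega
    · rw [ind_of_ne hix]
      omega
  refine ⟨ρ.addEdge hadj b hc', ?_, fun i => ?_, ?_⟩
  · rw [total_addEdge, hρ, total_removeEdge]
  · rw [utility_addEdge]
    have := hρu i
    omega
  -- Removing the unit on `yz` creates no excess, because `ν` strictly exceeds `μ` there; the unit
  -- added on `xy` strictly lowers it.
  · have key : ∀ i j, μ.exch i j - (ν.exch i j - edgeUnit y z i j + edgeUnit x y i j) ≤
        μ.exch i j - ν.exch i j := fun i j => by
      obtain ⟨h | h, h1⟩ | ⟨-, h0⟩ := edgeUnit_cases hyz i j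
      · obtain ⟨rfl, rfl⟩ := h
        omega
      · obtain ⟨rfl, rfl⟩ := h
        rw [μ.exch_symm i, ν.exch_symm i]
        omega
      · omega
    refine Finset.sum_lt_sum (fun i _ => Finset.sum_le_sum fun j _ => key i j)
      ⟨x, Finset.mem_univ _, Finset.sum_lt_sum (fun j _ => key x j) ⟨y, Finset.mem_univ _, ?_⟩⟩
    change μ.exch x y - (ν.exch x y - edgeUnit y z x y + edgeUnit x y x y) <
      μ.exch x y - ν.exch x y
    have h1 : edgeUnit x y x y = 1 := by simp [edgeUnit, ind_of_ne hadj.ne]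
    have h2 : edgeUnit y z x y = 0 := by
      simp [edgeUnit, ind_of_ne hadj.ne, ind_of_ne hxz]
    omega

end Exchange

/-! ### Maximum matchings: Gallai's lemma and the stability lemma. -/

section Maximum

variable {V : Type*} [Fintype V] {G : SimpleGraph V} {b : V → ℕ}

theorem total_le (μ : BMatching G b) : μ.total ≤ ∑ i, b i :=
  Finset.sum_le_sum fun i _ => μ.utility_le i

variable (G b) in
theorem exists_isMaximum : ∃ μ : BMatching G b, μ.IsMaximum := by
  let e : BMatching G b := ⟨fun _ _ => 0, fun _ _ => rfl, fun _ _ _ => rfl, fun i => by simp⟩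
  have hb : BddAbove (Set.range (total : BMatching G b → ℕ)) :=
    ⟨∑ i, b i, by rintro _ ⟨μ, rfl⟩; exact μ.total_le⟩
  obtain ⟨μ, hμ⟩ := Nat.sSup_mem (s := Set.range (total : BMatching G b → ℕ)) ⟨_, e, rfl⟩ hb
  refine ⟨μ, fun ν => ?_⟩
  have := le_csSup hb ⟨ν, rfl⟩
  rw [← hμ] at this
  exact this

theorem IsMaximum.total_le {μ : BMatching G b} (h : μ.IsMaximum) (ν : BMatching G b) :
    ν.total ≤ μ.total := h ν

theorem IsMaximum.of_total_le {μ ν : BMatching G b} (h : μ.IsMaximum) (hν : μ.total ≤ ν.total) :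
    ν.IsMaximum := fun ρ => (h.total_le ρ).trans hν

theorem IsMaximum.total_eq {μ ν : BMatching G b} (h : μ.IsMaximum) (hν : ν.IsMaximum) :
    μ.total = ν.total := le_antisymm (hν.total_le μ) (h.total_le ν)

/-- Both `u` and `v` have a unit of unused capacity (two units if `u = v`). -/
abbrev Misses (μ : BMatching G b) (u v : V) : Prop := ∀ i, μ.utility i + ind u i + ind v i ≤ b i

theorem Misses.symm {μ : BMatching G b} {u v : V} (h : μ.Misses u v) : μ.Misses v u :=
  fun i => by have := h i; omega

theorem misses_of_ne {μ : BMatching G b} {u v : V} (huv : u ≠ v) (hu : μ.utility u < b u)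
    (hv : μ.utility v < b v) : μ.Misses u v := fun i => by
  by_cases h1 : i = u
  · subst h1
    rw [ind_self, ind_of_ne huv]
    omega
  · rw [ind_of_ne h1]
    by_cases h2 : i = v
    · subst h2
      rw [ind_self]
      omega
    · rw [ind_of_ne h2]
      exact μ.utility_le i

theorem utility_eq_of_notMem {μ : BMatching G b} (h : μ.IsMaximum) {i : V}
    (hi : i ∉ underDemanded G b) : μ.utility i = b i := by
  by_contra hne
  exact hi ⟨μ, h, lt_of_le_of_ne (μ.utility_le i) hne⟩

theorem not_misses_of_adj {μ : BMatching G b} (h : μ.IsMaximum) {u v : V} (huv : G.Adj u v) :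
    ¬ μ.Misses u v := fun hm => by
  have := h.total_le (μ.addEdge huv b hm)
  rw [total_addEdge] at this
  omega

/-- Gallai's lemma, as transitivity of the relation "never missed together". -/
theorem not_misses_trans {u t v : V} (ht : t ∈ underDemanded G b)
    (hut : ∀ μ : BMatching G b, μ.IsMaximum → ¬ μ.Misses u t)
    (htv : ∀ μ : BMatching G b, μ.IsMaximum → ¬ μ.Misses t v)
    (μ : BMatching G b) (hμ : μ.IsMaximum) : ¬ μ.Misses u v := by
  intro hm
  have htu : t ≠ u := by rintro rfl; exact htv μ hμ hm
  have htv' : t ≠ v := by rintro rfl; exact hut μ hμ hm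
  have hmu : μ.utility u < b u := by
    have := hm u
    rw [ind_self] at this
    omega
  have hmt : b t ≤ μ.utility t := by
    by_contra! hlt
    exact hut μ hμ (misses_of_ne htu.symm hmu hlt)
  -- Descent among maximum matchings that miss `t`, measured by the excess of `μ` over them.
  have main : ∀ n, ∀ ν : BMatching G b, ν.IsMaximum → ν.utility t < b t →
      excess μ ν = n → False := by
    intro n
    induction n using Nat.strong_induction_on with
    | _ n ih =>
      intro ν hν hνt hn
      have hνu : b u ≤ ν.utility u := by
        by_contra! hlt
        exact hut ν hν (misses_of_ne htu.symm hlt hνt)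
      have hνv : b v ≤ ν.utility v := by
        by_contra! hlt
        exact htv ν hν (misses_of_ne htv' hνt hlt)
      -- The totals agree, while `μ` has two marked spare units and `ν` only one; summing over all
      -- agents forces a strict inequality somewhere.
      obtain ⟨x, hx⟩ : ∃ x, ν.utility x + ind t x < μ.utility x + ind u x + ind v x := by
        by_contra! hcon
        have := Finset.sum_le_sum fun i (_ : i ∈ Finset.univ) => hcon i
        simp only [Finset.sum_add_distrib, sum_ind] at this
        have h2 := hμ.total_eq hν
        unfold total at h2
        omega
      have hxu : x ≠ u := by
        rintro rfl
        have := hm x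
        omega
      have hxv : x ≠ v := by
        rintro rfl
        have := hm x
        omega
      rw [ind_of_ne hxu, ind_of_ne hxv] at hx
      have hμx := μ.utility_le x
      obtain ⟨y, hxy, hy⟩ | ⟨ν', h1, h2, h3⟩ := exists_partner_or_reroute μ ν (x := x) (by omega)
      · exact not_misses_of_adj hν hxy (misses_of_ne hxy.ne (by omega) hy)
      -- Rerouting can raise the utility of `t` only if `x = t`, and then the strict inequality for
      -- `x` leaves `t` another spare unit.
      · refine ih _ (hn ▸ h3) ν' (hν.of_total_le h1.ge) ?_ rfl
        have := h2 t
        by_cases hxt : t = x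
        · subst hxt
          rw [ind_self] at *
          omega
        · rw [ind_of_ne hxt] at this
          omega
  obtain ⟨ν, hν, hνt⟩ := ht
  exact main _ ν hν hνt rfl

/-- A matching one unit short of maximum that misses an over-demanded agent `a` misses, apart
from that unit of `a`, only under-demanded agents. -/
theorem mem_underDemanded_of_misses {a v : V} (ha : a ∈ overDemanded G b)
    {μ : BMatching G b} (hμ : μ.IsMaximum) (ρ : BMatching G b) (hρ : ρ.total + 2 = μ.total)
    (hm : ρ.Misses a v) : v ∈ underDemanded G b := by
  obtain ⟨haD, w, ⟨ν, hν, hνw⟩, haw⟩ := ha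
  by_contra hv
  have hνa := utility_eq_of_notMem hν haD
  have hνv := utility_eq_of_notMem hν hv
  have hwa : w ≠ a := haw.ne'
  have hwv : w ≠ v := by rintro rfl; exact hv ⟨ν, hν, hνw⟩
  have htot := hμ.total_eq hν
  -- Adding an available edge makes `ρ` maximum, so it must then saturate everyone outside V^U.
  have hadd : ∀ ρ : BMatching G b, ρ.total + 2 = μ.total → ∀ x y, (hxy : G.Adj x y) →
      (hc : ρ.Misses x y) → ∀ i, i ∉ underDemanded G b →
        b i ≤ ρ.utility i + ind x i + ind y i := by
    intro ρ hρ x y hxy hc i hi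
    by_contra! hlt
    refine hi ⟨ρ.addEdge hxy b hc, hμ.of_total_le ?_, ?_⟩
    · rw [total_addEdge, hρ]
    · rw [utility_addEdge]
      exact hlt
  have main : ∀ n, ∀ ρ : BMatching G b, ρ.total + 2 = μ.total → ρ.Misses a v →
      excess ν ρ = n → False := by
    intro n
    induction n using Nat.strong_induction_on with
    | _ n ih =>
      intro ρ hρ hm hn
      have hma := hm a
      have hmv := hm v
      rw [ind_self] at hma hmv
      have hρw : b w ≤ ρ.utility w := by
        by_contra! hlt
        have := hadd ρ hρ a w haw (misses_of_ne hwa.symm (by omega) hlt) v hv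
        rw [ind_of_ne hwv.symm] at this
        omega
      -- `ρ` together with its two missed units has the total of `ν`, and the unit that `ν` misses
      -- at `w` makes the comparison strict.
      obtain ⟨x, hx⟩ : ∃ x, ρ.utility x + ind a x + ind v x < ν.utility x + ind w x := by
        by_contra! hcon
        have := Finset.sum_le_sum fun i (_ : i ∈ Finset.univ) => hcon i
        simp only [Finset.sum_add_distrib, sum_ind] at this
        unfold total at *
        omega
      have hxw : x ≠ w := by
        rintro rfl
        rw [ind_self, ind_of_ne hwa, ind_of_ne hwv] at hx
        omega
      rw [ind_of_ne hxw] at hx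
      have hνx := ν.utility_le x
      obtain ⟨y, hxy, hy⟩ | ⟨ρ', h1, h2, h3⟩ := exists_partner_or_reroute ν ρ (x := x) (by omega)
      -- The new edge would have to saturate both `a` and `v`. The slack at `x` exceeds what one
      -- unit can fill there, so `y = a = v`; but then two units are missing at `y` and only one is
      -- supplied.
      · have hmxy : ρ.Misses x y := misses_of_ne hxy.ne (by omega) hy
        have h1 := hadd ρ hρ x y hxy hmxy a haD
        have h2 := hadd ρ hρ x y hxy hmxy v hv
        have hya : y = a := by
          by_contra hne
          rw [ind_of_ne (Ne.symm hne)] at h1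
          by_cases hxa : a = x
          · subst hxa
            rw [ind_self] at *
            omega
          · rw [ind_of_ne hxa] at h1
            omega
        have hyv : y = v := by
          by_contra hne
          rw [ind_of_ne (Ne.symm hne)] at h2
          by_cases hxv : v = x
          · subst hxv
            rw [ind_self] at *
            omega
          · rw [ind_of_ne hxv] at h2
            omega
        subst hya hyv
        rw [ind_self] at *
        rw [ind_of_ne hxy.ne'] at h1
        omega
      · refine ih _ (hn ▸ h3) ρ' (by omega) (fun i => ?_) rfl
        have h4 := h2 i
        have h5 := hm i
        by_cases hix : i = x
        · subst hix
          rw [ind_self] at h4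
          omega
        · rw [ind_of_ne hix] at h4
          omega
  exact main _ ρ hρ hm rfl

end Maximum

end BMatching

namespace BMatching

/-! ### Shutting down the over-demanded agents. -/

section Reduction

variable {V : Type*} [Fintype V] {G : SimpleGraph V} {b : V → ℕ}

theorem exists_exch_pos (μ : BMatching G b) {i : V} (h : 0 < μ.utility i) :
    ∃ j, 0 < μ.exch i j := by
  by_contra! hcon
  have : μ.utility i = 0 := Finset.sum_eq_zero fun j _ => Nat.le_zero.mp (hcon j)
  omega

theorem exch_eq_zero_of_utility (μ : BMatching G b) {i : V} (h : μ.utility i = 0) (j : V) :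
    μ.exch i j = 0 := Finset.sum_eq_zero_iff.mp h j (Finset.mem_univ j)

theorem overDemanded_congr {c : V → ℕ} (h : underDemanded G c = underDemanded G b) :
    overDemanded G c = overDemanded G b := by
  unfold overDemanded
  rw [h]

/-- In a maximum matching, over-demanded agents only deal with under-demanded ones. -/
theorem mem_underDemanded_of_exch_pos {μ : BMatching G b} (hμ : μ.IsMaximum) {a v : V}
    (ha : a ∈ overDemanded G b) (h : 0 < μ.exch a v) : v ∈ underDemanded G b := by
  have hc : ∀ i, μ.utility i ≤ b i + ind a i + ind v i := fun i => by
    have := μ.utility_le i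
    omega
  refine mem_underDemanded_of_misses ha hμ (μ.removeEdge h b hc) (total_removeEdge μ h b hc) ?_
  intro i
  rw [utility_removeEdge]
  exact μ.utility_le i

/-- Removing one unit of capacity from an over-demanded agent. -/
theorem lower_overDemanded {a : V} (ha : a ∈ overDemanded G b) (h0 : 0 < b a) :
    underDemanded G (fun i => b i - ind a i) = underDemanded G b ∧
      ∀ (μ : BMatching G b) (ν : BMatching G fun i => b i - ind a i),
        μ.IsMaximum → ν.IsMaximum → μ.total = ν.total + 2 := by
  have hcb : ∀ i, (b i - ind a i) + ind a i = b i := fun i => by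
    by_cases hi : i = a
    · subst hi
      rw [ind_self]
      omega
    · rw [ind_of_ne hi]
      omega
  have hadown : ∀ M : BMatching G b, M.IsMaximum →
      ∃ M' : BMatching G fun i => b i - ind a i, M'.total + 2 = M.total ∧
        ∀ i, M'.utility i + ind a i ≤ M.utility i := by
    intro M hM
    have hMa := utility_eq_of_notMem hM ha.1
    obtain ⟨k, hk⟩ := M.exists_exch_pos (i := a) (by omega)
    have hc : ∀ i, M.utility i ≤ b i - ind a i + ind a i + ind k i := fun i => by
      have := M.utility_le i
      have := hcb i
      omega
    refine ⟨M.removeEdge hk _ hc, total_removeEdge M hk _ hc, fun i => ?_⟩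
    have := utility_removeEdge M hk _ hc i
    omega
  -- A matching for the lowered peaks leaves `a` unsaturated for `b`, so it is not maximum there;
  -- parity turns a deficit of at least one into at least two.
  have hup : ∀ (M : BMatching G b) (M' : BMatching G fun i => b i - ind a i), M.IsMaximum →
      M'.total + 2 ≤ M.total := by
    intro M M' hM
    let N : BMatching G b := M'.ofLE b fun i => (M'.utility_le i).trans (Nat.sub_le _ _)
    have hN : N.total ≤ M.total := hM.total_le N
    have hNM : N.total = M'.total := rfl
    rcases eq_or_ne N.total M.total with heq | hne
    · have h1 := utility_eq_of_notMem (hM.of_total_le heq.ge) ha.1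
      have h2 : N.utility a ≤ b a - ind a a := M'.utility_le a
      rw [ind_self] at h2
      omega
    · have h1 := M.even_total
      have h2 := N.even_total
      rw [Nat.even_iff] at h1 h2
      omega
  have hmax : ∀ (μ : BMatching G b) (ν : BMatching G fun i => b i - ind a i),
        μ.IsMaximum → ν.IsMaximum → μ.total = ν.total + 2 := by
    intro μ ν hμ hν
    obtain ⟨M', h1, -⟩ := hadown μ hμ
    have := hup μ ν hμ
    have := hν.total_le M'
    omega
  refine ⟨Set.ext fun v => ⟨?_, ?_⟩, hmax⟩
  -- Regarded with the peaks `b`, `ν` is two short of maximum and misses both `a` and `v`, so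
  -- stability applies.
  · rintro ⟨ν, hν, hlt⟩
    change ν.utility v < b v - ind a v at hlt
    obtain ⟨μ, hμ⟩ := exists_isMaximum G b
    let N : BMatching G b := ν.ofLE b fun i => (ν.utility_le i).trans (Nat.sub_le _ _)
    refine mem_underDemanded_of_misses ha hμ N (hmax μ ν hμ hν).symm fun i => ?_
    have h1 : N.utility i = ν.utility i := rfl
    have h2 : ν.utility i ≤ b i - ind a i := ν.utility_le i
    have h3 := hcb i
    by_cases hi : i = v
    · subst hi
      rw [ind_self]
      omega
    · rw [ind_of_ne hi]
      omega
  · rintro ⟨μ, hμ, hlt⟩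
    obtain ⟨M', h1, h2⟩ := hadown μ hμ
    refine ⟨M', fun ρ => ?_, ?_⟩
    · have : ρ.total + 2 ≤ μ.total := hup μ ρ hμ
      change ρ.total ≤ M'.total
      omega
    · change M'.utility v < b v - ind a v
      have := h2 v
      have := hcb v
      omega

open Classical in
variable (G b) in
/-- The peaks, except that the over-demanded agents are shut down. -/
noncomputable def coreCap (i : V) : ℕ := if i ∈ overDemanded G b then 0 else b i

open Classical in
-- Induction on the total peak of V^O: lowering one unit preserves V^U, hence V^O, so the same set
-- keeps being drained until its peaks are all zero.
theorem core_spec (n : ℕ) : ∀ b : V → ℕ, ∑ i with i ∈ overDemanded G b, b i = n →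
    underDemanded G (coreCap G b) = underDemanded G b ∧
      ∀ (μ : BMatching G b) (ν : BMatching G (coreCap G b)), μ.IsMaximum → ν.IsMaximum →
        μ.total = ν.total + 2 * ∑ i with i ∈ overDemanded G b, b i := by
  induction n with
  | zero =>
    intro b hb
    have hcore : coreCap G b = b := by
      funext i
      unfold coreCap
      split_ifs with hi
      · exact (Finset.sum_eq_zero_iff.mp hb i (by simpa using hi)).symm
      · rfl
    rw [hb]
    refine ⟨by rw [hcore], ?_⟩
    rw [hcore]
    intro μ ν hμ hν
    exact hμ.total_eq hν
  | succ n ih =>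
    intro b hb
    obtain ⟨a, ha, ha0⟩ : ∃ a ∈ overDemanded G b, 0 < b a := by
      by_contra! hcon
      rw [Finset.sum_eq_zero fun i hi => Nat.le_zero.mp (hcon i (by simpa using hi))] at hb
      omega
    obtain ⟨h1, h2⟩ := lower_overDemanded ha ha0
    have hO := overDemanded_congr h1
    have hsum : ∑ i with i ∈ overDemanded G b, (b i - ind a i) + 1 =
        ∑ i with i ∈ overDemanded G b, b i := by
      have h3 : ∑ i with i ∈ overDemanded G b, ind a i = 1 := by
        simp [ind, ha]
      rw [← h3, ← Finset.sum_add_distrib]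
      refine Finset.sum_congr rfl fun i _ => Nat.sub_add_cancel ?_
      by_cases hi : i = a
      · subst hi
        rw [ind_self]
        omega
      · rw [ind_of_ne hi]
        omega
    have hcore : coreCap G (fun i => b i - ind a i) = coreCap G b := by
      funext i
      unfold coreCap
      rw [hO]
      split_ifs with hi
      · rfl
      · have hne : i ≠ a := by rintro rfl; exact hi ha
        simp [ind_of_ne hne]
    obtain ⟨h3, h4⟩ := ih (fun i => b i - ind a i) (by rw [hO]; omega)
    rw [hcore, hO] at *
    refine ⟨h3.trans h1, fun μ ν hμ hν => ?_⟩
    obtain ⟨ρ, hρ⟩ := exists_isMaximum G fun i => b i - ind a i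
    have := h2 μ ρ hμ hρ
    have := h4 ρ ν hρ hν
    omega

theorem underDemanded_core : underDemanded G (coreCap G b) = underDemanded G b :=
  (core_spec _ b rfl).1

open Classical in
theorem total_eq_core {μ : BMatching G b} {ν : BMatching G (coreCap G b)} (hμ : μ.IsMaximum)
    (hν : ν.IsMaximum) : μ.total = ν.total + 2 * ∑ i with i ∈ overDemanded G b, b i :=
  (core_spec _ b rfl).2 μ ν hμ hν

theorem coreCap_of_mem {i : V} (h : i ∈ overDemanded G b) : coreCap G b i = 0 := by
  simp [coreCap, h]

theorem coreCap_of_notMem {i : V} (h : i ∉ overDemanded G b) : coreCap G b i = b i := by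
  simp [coreCap, h]

theorem core_utility_of_mem (ν : BMatching G (coreCap G b)) {i : V} (h : i ∈ overDemanded G b) :
    ν.utility i = 0 := by
  have := ν.utility_le i
  rw [coreCap_of_mem h] at this
  omega

theorem core_exch_left (ν : BMatching G (coreCap G b)) {i : V} (h : i ∈ overDemanded G b) (j : V) :
    ν.exch i j = 0 := ν.exch_eq_zero_of_utility (ν.core_utility_of_mem h) j

theorem core_exch_right (ν : BMatching G (coreCap G b)) {j : V} (h : j ∈ overDemanded G b) (i : V) :
    ν.exch i j = 0 := by rw [ν.exch_symm, ν.core_exch_left h]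

theorem core_utility_of_perfectlyDemanded {ν : BMatching G (coreCap G b)} (hν : ν.IsMaximum) {i : V}
    (hi : i ∈ perfectlyDemanded G b) : ν.utility i = b i := by
  rw [utility_eq_of_notMem hν (by rw [underDemanded_core]; exact hi.1), coreCap_of_notMem hi.2]

/-- In the core, under-demanded agents only deal with each other. -/
theorem core_mem_underDemanded (ν : BMatching G (coreCap G b)) {i j : V}
    (hi : i ∈ underDemanded G b) (h : 0 < ν.exch i j) : j ∈ underDemanded G b := by
  by_contra hj
  have : j ∈ overDemanded G b := ⟨hj, i, hi, (ν.adj_of_exch_pos h).symm⟩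
  rw [ν.core_exch_right this] at h
  omega

end Reduction

/-! ### Odd components are critical. -/

section Components

variable {V : Type*} [Fintype V] {G : SimpleGraph V} {b : V → ℕ}

/-- Adjacent agents are never missed together, and Gallai's lemma chains this along the walk.
Positive length is needed because an isolated agent may miss two units. -/
theorem not_misses_of_walk {D : Set V} (hD : D ⊆ underDemanded G b) {u v : D}
    (p : (G.induce D).Walk u v) (hp : 0 < p.length) :
    ∀ μ : BMatching G b, μ.IsMaximum → ¬ μ.Misses u v := by
  induction p with
  | nil => simp at hp
  | @cons u t v h p ih =>
    intro μ hμ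
    rcases Nat.eq_zero_or_pos p.length with h0 | h0
    · obtain rfl := SimpleGraph.Walk.eq_of_length_eq_zero h0
      exact not_misses_of_adj hμ h
    · exact not_misses_trans (hD t.2) (fun μ hμ => not_misses_of_adj hμ h) (ih h0) μ hμ

/-- A detour through a second agent of the component makes the walk nontrivial even when `u = v`, so
no single agent misses two units either. -/
theorem not_misses_of_mem_agents {C : OddComponent G b} (hC : 2 ≤ (OddComponent.agents C).ncard)
    {c : V → ℕ} (hc : underDemanded G c = underDemanded G b) {u v : V}
    (hu : u ∈ OddComponent.agents C) (hv : v ∈ OddComponent.agents C)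
    {μ : BMatching G c} (hμ : μ.IsMaximum) : ¬ μ.Misses u v := by
  obtain ⟨w, hw, hwu⟩ := Set.exists_ne_of_one_lt_ncard hC u
  obtain ⟨u, hu, rfl⟩ := hu
  obtain ⟨v, hv, rfl⟩ := hv
  obtain ⟨w, hw, rfl⟩ := hw
  obtain ⟨p⟩ := SimpleGraph.ConnectedComponent.exact (hu.trans hw.symm)
  obtain ⟨q⟩ := SimpleGraph.ConnectedComponent.exact (hw.trans hv.symm)
  refine not_misses_of_walk hc.ge (p.append q) ?_ μ hμ
  rw [SimpleGraph.Walk.length_append]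
  by_contra! h
  exact hwu (by rw [SimpleGraph.Walk.eq_of_length_eq_zero (p := p) (by omega)])

theorem mem_agents_iff {C : OddComponent G b} {i : V} : i ∈ OddComponent.agents C ↔
    ∃ h : i ∈ underDemanded G b, (G.induce (underDemanded G b)).connectedComponentMk ⟨i, h⟩ = C := by
  constructor
  · rintro ⟨i, hi, rfl⟩
    exact ⟨i.2, hi⟩
  · rintro ⟨h, hC⟩
    exact ⟨⟨i, h⟩, hC, rfl⟩

theorem underDemanded_of_mem_agents {C : OddComponent G b} {i : V}
    (h : i ∈ OddComponent.agents C) : i ∈ underDemanded G b := (mem_agents_iff.mp h).1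

theorem eq_of_mem_agents {C C' : OddComponent G b} {i : V} (h : i ∈ OddComponent.agents C)
    (h' : i ∈ OddComponent.agents C') : C = C' := by
  obtain ⟨_, rfl⟩ := mem_agents_iff.mp h
  obtain ⟨_, rfl⟩ := mem_agents_iff.mp h'
  rfl

theorem mem_agents_of_adj {C : OddComponent G b} {i j : V} (hi : i ∈ OddComponent.agents C)
    (hj : j ∈ underDemanded G b) (h : G.Adj i j) : j ∈ OddComponent.agents C := by
  obtain ⟨hi', rfl⟩ := mem_agents_iff.mp hi
  refine mem_agents_iff.mpr ⟨hj, SimpleGraph.ConnectedComponent.sound ?_⟩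
  exact SimpleGraph.Adj.reachable (G := G.induce (underDemanded G b)) (u := ⟨j, hj⟩)
    (v := ⟨i, hi'⟩) h.symm

theorem notMem_overDemanded {i : V} (h : i ∈ underDemanded G b) : i ∉ overDemanded G b :=
  fun ho => ho.1 h

theorem core_mem_agents (ν : BMatching G (coreCap G b)) {C : OddComponent G b} {i j : V}
    (hi : i ∈ OddComponent.agents C) (h : 0 < ν.exch i j) : j ∈ OddComponent.agents C :=
  mem_agents_of_adj hi (ν.core_mem_underDemanded (underDemanded_of_mem_agents hi) h)
    (ν.adj_of_exch_pos h)

theorem core_deficit {C : OddComponent G b} (hC : 2 ≤ (OddComponent.agents C).ncard)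
    {ν : BMatching G (coreCap G b)} (hν : ν.IsMaximum) {u : V} (hu : u ∈ OddComponent.agents C)
    (hlt : ν.utility u < b u) {i : V} (hi : i ∈ OddComponent.agents C) :
    ν.utility i + ind u i = b i := by
  have hcap : ∀ {i}, i ∈ OddComponent.agents C → coreCap G b i = b i := fun hi =>
    coreCap_of_notMem (notMem_overDemanded (underDemanded_of_mem_agents hi))
  have hle := ν.utility_le i
  have hm := not_misses_of_mem_agents hC underDemanded_core hu hi hν
  rw [hcap hi] at hle
  by_cases h : i = u
  · subst h
    rw [ind_self]
    by_contra hne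
    refine hm fun k => ?_
    by_cases hk : k = i
    · subst hk
      rw [ind_self, hcap hi]
      omega
    · rw [ind_of_ne hk]
      exact ν.utility_le k
  · rw [ind_of_ne h]
    by_contra hne
    exact hm (misses_of_ne (Ne.symm h) (by rwa [hcap hu]) (by rw [hcap hi]; omega))

/-- Every odd component with at least two agents is critical: for each of its agents `u`, some
maximum matching of the core is perfect on the component up to one unit at `u`. -/
theorem exists_core_deficit {C : OddComponent G b} (hC : 2 ≤ (OddComponent.agents C).ncard) {u : V}
    (hu : u ∈ OddComponent.agents C) : ∃ ν : BMatching G (coreCap G b), ν.IsMaximum ∧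
      ∀ i ∈ OddComponent.agents C, ν.utility i + ind u i = b i := by
  have hD := underDemanded_of_mem_agents hu
  have hD' := hD
  rw [← underDemanded_core] at hD'
  obtain ⟨ν, hν, hlt⟩ := hD'
  rw [coreCap_of_notMem (notMem_overDemanded hD)] at hlt
  exact ⟨ν, hν, fun i hi => core_deficit hC hν hu hlt hi⟩

theorem agents_nonempty (C : OddComponent G b) : (OddComponent.agents C).Nonempty :=
  C.nonempty_supp.image _

open Classical in
theorem core_utility_agents (ν : BMatching G (coreCap G b)) {C : OddComponent G b} {i : V}
    (hi : i ∈ OddComponent.agents C) :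
    ∑ j with j ∈ OddComponent.agents C, ν.exch i j = ν.utility i := by
  refine Finset.sum_subset (Finset.subset_univ _) fun j _ hj => ?_
  by_contra hne
  exact hj (by simpa using ν.core_mem_agents hi (Nat.pos_of_ne_zero hne))

open Classical in
theorem core_even_agents (ν : BMatching G (coreCap G b)) (C : OddComponent G b) :
    Even (∑ i with i ∈ OddComponent.agents C, ν.utility i) := by
  have := even_sum_of_symm ({i | i ∈ OddComponent.agents C} : Finset V) ν.exch ν.exch_symm
    ν.exch_self
  rwa [Finset.sum_congr rfl fun i hi =>
    ν.core_utility_agents (C := C) (by simpa using hi)] at this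

open Classical in
theorem core_sum_agents_of_deficit {C : OddComponent G b} {ν : BMatching G (coreCap G b)} {u : V}
    (hu : u ∈ OddComponent.agents C)
    (h : ∀ i ∈ OddComponent.agents C, ν.utility i + ind u i = b i) :
    ∑ i with i ∈ OddComponent.agents C, ν.utility i + 1 = OddComponent.peakSum C := by
  have h3 : ∑ i with i ∈ OddComponent.agents C, ind u i = 1 := by
    simp [ind, hu]
  unfold OddComponent.peakSum
  rw [← h3, ← Finset.sum_add_distrib]
  exact Finset.sum_congr rfl fun i hi => h i (by simpa using hi)

/-- In the core a component trades only with itself, so its utilities have an even sum; criticality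
supplies a matching that falls short of the peaks by exactly one. -/
theorem odd_peakSum {C : OddComponent G b} (hC : 2 ≤ (OddComponent.agents C).ncard) :
    Odd (OddComponent.peakSum C) := by
  obtain ⟨u, hu⟩ := agents_nonempty C
  obtain ⟨ν, -, h⟩ := exists_core_deficit hC hu
  rw [← core_sum_agents_of_deficit hu h]
  exact (ν.core_even_agents C).add_one

open Classical in
-- At most one unit is missed, and parity rules out missing none.
theorem core_sum_agents {C : OddComponent G b} (hC : 2 ≤ (OddComponent.agents C).ncard)
    {ν : BMatching G (coreCap G b)} (hν : ν.IsMaximum) :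
    ∑ i with i ∈ OddComponent.agents C, ν.utility i + 1 = OddComponent.peakSum C := by
  by_cases h : ∃ u ∈ OddComponent.agents C, ν.utility u < b u
  · obtain ⟨u, hu, hlt⟩ := h
    exact core_sum_agents_of_deficit hu fun i hi => core_deficit hC hν hu hlt hi
  · push Not at h
    exfalso
    have h1 : ∑ i with i ∈ OddComponent.agents C, ν.utility i = OddComponent.peakSum C := by
      refine Finset.sum_congr rfl fun i hi => ?_
      have hi' : i ∈ OddComponent.agents C := by simpa using hi
      refine le_antisymm ((ν.utility_le i).trans ?_) (h i hi')
      rw [coreCap_of_notMem (notMem_overDemanded (underDemanded_of_mem_agents hi'))]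
    have h2 := ν.core_even_agents C
    rw [h1] at h2
    exact Nat.not_even_iff_odd.mpr (odd_peakSum hC) h2

open Classical in
/-- The part of a matching outside the over-demanded agents. -/
noncomputable def toCore (μ : BMatching G b) : BMatching G (coreCap G b) where
  exch i j := if i ∈ overDemanded G b ∨ j ∈ overDemanded G b then 0 else μ.exch i j
  exch_symm i j := by simp only [or_comm, μ.exch_symm i j]
  exch_eq_zero i j h := by rw [μ.exch_eq_zero i j h, ite_self]
  sum_exch_le i := by
    by_cases hi : i ∈ overDemanded G b
    · simp [hi]
    · rw [coreCap_of_notMem hi]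
      refine (Finset.sum_le_sum fun j _ => ?_).trans (μ.sum_exch_le i)
      split_ifs <;> simp

theorem toCore_exch {μ : BMatching G b} {i j : V} (hi : i ∉ overDemanded G b)
    (hj : j ∉ overDemanded G b) : μ.toCore.exch i j = μ.exch i j := by
  simp [toCore, hi, hj]

/-- Deleting all trades of V^O lowers the total by at most twice the peaks of V^O, which is exactly
the gap between the two maxima. -/
theorem toCore_isMaximum {μ : BMatching G b} (hμ : μ.IsMaximum) : μ.toCore.IsMaximum := by
  classical
  obtain ⟨ν, hν⟩ := exists_isMaximum G (coreCap G b)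
  refine hν.of_total_le ?_
  have h1 := total_eq_core hμ hν
  have h2 : μ.total ≤ μ.toCore.total + 2 * ∑ i with i ∈ overDemanded G b, b i := by
    have h3 : ∀ i j, μ.exch i j ≤ μ.toCore.exch i j +
        (if i ∈ overDemanded G b then μ.exch i j else 0) +
        (if j ∈ overDemanded G b then μ.exch j i else 0) := fun i j => by
      rw [μ.exch_symm j i]
      unfold toCore
      by_cases hi : i ∈ overDemanded G b <;> by_cases hj : j ∈ overDemanded G b <;> simp [hi, hj]
    have h4 : ∑ i, ∑ j, (if i ∈ overDemanded G b then μ.exch i j else 0) ≤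
        ∑ i with i ∈ overDemanded G b, b i := by
      rw [Finset.sum_filter]
      refine Finset.sum_le_sum fun i _ => ?_
      split_ifs
      · exact μ.sum_exch_le i
      · simp
    have h5 := Finset.sum_le_sum fun i (_ : i ∈ Finset.univ) =>
      Finset.sum_le_sum fun j (_ : j ∈ Finset.univ) => h3 i j
    simp only [Finset.sum_add_distrib] at h5
    rw [Finset.sum_comm (f := fun i j => if j ∈ overDemanded G b then μ.exch j i else 0)] at h5
    have h6 : μ.total = ∑ i, ∑ j, μ.exch i j := rfl
    have h7 : μ.toCore.total = ∑ i, ∑ j, μ.toCore.exch i j := rfl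
    omega
  omega

open Classical in
theorem sum_sum_exch_agents {μ : BMatching G b} (hμ : μ.IsMaximum) {C : OddComponent G b}
    (hC : 2 ≤ (OddComponent.agents C).ncard) :
    ∑ i with i ∈ OddComponent.agents C, ∑ j with j ∈ OddComponent.agents C, μ.exch i j + 1 =
      OddComponent.peakSum C := by
  rw [← core_sum_agents hC (toCore_isMaximum hμ)]
  congr 1
  refine Finset.sum_congr rfl fun i hi => ?_
  have hi' : i ∈ OddComponent.agents C := by simpa using hi
  rw [← core_utility_agents _ hi']
  refine Finset.sum_congr rfl fun j hj => ?_
  have hj' : j ∈ OddComponent.agents C := by simpa using hj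
  exact (toCore_exch (notMem_overDemanded (underDemanded_of_mem_agents hi'))
    (notMem_overDemanded (underDemanded_of_mem_agents hj'))).symm

end Components

end BMatching

/-! ### Flows and their integral decomposition. -/

namespace BipartiteNetwork

universe u v

variable {A : Type u} {B : Type v} [Fintype A] [Fintype B] {N : BipartiteNetwork A B}

theorem Flow.value_eq_sum_toSink (φ : N.Flow) : φ.value = ∑ c, φ.toSink c := by
  unfold Flow.value
  simp_rw [φ.conservation_left, ← φ.conservation_right]
  exact Finset.sum_comm

theorem Flow.across_le_fromSource (φ : N.Flow) (a : A) (c : B) :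
    φ.across a c ≤ φ.fromSource a := by
  rw [φ.conservation_left]
  exact Finset.single_le_sum (fun c _ => φ.across_nonneg a c) (Finset.mem_univ c)

theorem Flow.across_le_toSink (φ : N.Flow) (a : A) (c : B) : φ.across a c ≤ φ.toSink c := by
  rw [← φ.conservation_right]
  exact Finset.single_le_sum (fun a _ => φ.across_nonneg a c) (Finset.mem_univ a)

theorem Flow.across_eq_zero_of_leftCap (φ : N.Flow) {a : A} (h : N.leftCap a = 0) (c : B) :
    φ.across a c = 0 := by
  have h1 := (φ.across_le_fromSource a c).trans (φ.fromSource_le a)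
  rw [h, Nat.cast_zero] at h1
  exact le_antisymm h1 (φ.across_nonneg a c)

theorem Flow.across_eq_zero_of_rightCap (φ : N.Flow) {c : B} (h : N.rightCap c = 0) (a : A) :
    φ.across a c = 0 := by
  have h1 := (φ.across_le_toSink a c).trans (φ.toSink_le c)
  rw [h, Nat.cast_zero] at h1
  exact le_antisymm h1 (φ.across_nonneg a c)

/-- The integral flow with the given natural numbers on the middle arcs. -/
noncomputable def Flow.ofNat (x : A → B → ℕ) (hl : ∀ a, ∑ c, x a c ≤ N.leftCap a)
    (hr : ∀ c, ∑ a, x a c ≤ N.rightCap c) (h0 : ∀ a c, ¬ N.arc a c → x a c = 0) : N.Flow where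
  fromSource a := ((∑ c, x a c : ℕ) : ℝ)
  across a c := x a c
  toSink c := ((∑ a, x a c : ℕ) : ℝ)
  fromSource_nonneg _ := Nat.cast_nonneg _
  fromSource_le a := Nat.cast_le.mpr (hl a)
  across_nonneg _ _ := Nat.cast_nonneg _
  across_eq_zero a c h := by rw [h0 a c h, Nat.cast_zero]
  toSink_nonneg _ := Nat.cast_nonneg _
  toSink_le c := Nat.cast_le.mpr (hr c)
  conservation_left a := by push_cast; rfl
  conservation_right c := by push_cast; rfl

theorem Flow.isIntegral_ofNat (x : A → B → ℕ) (hl : ∀ a, ∑ c, x a c ≤ N.leftCap a)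
    (hr : ∀ c, ∑ a, x a c ≤ N.rightCap c) (h0 : ∀ a c, ¬ N.arc a c → x a c = 0) :
    (Flow.ofNat x hl hr h0).IsIntegral :=
  ⟨fun a => ⟨(∑ c, x a c : ℕ), by simp [ofNat]⟩, fun a c => ⟨x a c, by simp [ofNat]⟩,
    fun c => ⟨(∑ a, x a c : ℕ), by simp [ofNat]⟩⟩

/-- A convex combination of flows. -/
noncomputable def Flow.combination {ι : Type*} (s : Finset ι) (w : ι → ℝ) (hw : ∀ i ∈ s, 0 ≤ w i)
    (hs : ∑ i ∈ s, w i = 1) (ψ : ι → N.Flow) : N.Flow where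
  fromSource a := ∑ i ∈ s, w i * (ψ i).fromSource a
  across a c := ∑ i ∈ s, w i * (ψ i).across a c
  toSink c := ∑ i ∈ s, w i * (ψ i).toSink c
  fromSource_nonneg a :=
    Finset.sum_nonneg fun i hi => mul_nonneg (hw i hi) ((ψ i).fromSource_nonneg a)
  fromSource_le a := by
    rw [← one_mul (N.leftCap a : ℝ), ← hs, Finset.sum_mul]
    exact Finset.sum_le_sum fun i hi =>
      mul_le_mul_of_nonneg_left ((ψ i).fromSource_le a) (hw i hi)
  across_nonneg a c :=
    Finset.sum_nonneg fun i hi => mul_nonneg (hw i hi) ((ψ i).across_nonneg a c)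
  across_eq_zero a c h :=
    Finset.sum_eq_zero fun i _ => by rw [(ψ i).across_eq_zero a c h, mul_zero]
  toSink_nonneg c :=
    Finset.sum_nonneg fun i hi => mul_nonneg (hw i hi) ((ψ i).toSink_nonneg c)
  toSink_le c := by
    rw [← one_mul (N.rightCap c : ℝ), ← hs, Finset.sum_mul]
    exact Finset.sum_le_sum fun i hi =>
      mul_le_mul_of_nonneg_left ((ψ i).toSink_le c) (hw i hi)
  conservation_left a := by
    rw [Finset.sum_comm]
    simp_rw [← Finset.mul_sum, ← (ψ _).conservation_left]
  conservation_right c := by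
    rw [Finset.sum_comm]
    simp_rw [← Finset.mul_sum, (ψ _).conservation_right]

section Birkhoff

/-- The unit copies of the left nodes. -/
abbrev LeftUnit (N : BipartiteNetwork A B) : Type _ := Σ a, Fin (N.leftCap a)

/-- The unit copies of the right nodes. -/
abbrev RightUnit (N : BipartiteNetwork A B) : Type _ := Σ c, Fin (N.rightCap c)

/-- The flow spread evenly over the unit copies. -/
noncomputable def Flow.spread (φ : N.Flow) (p : N.LeftUnit) (q : N.RightUnit) : ℝ :=
  φ.across p.1 q.1 / (N.leftCap p.1 * N.rightCap q.1)

theorem Flow.spread_nonneg (φ : N.Flow) (p : N.LeftUnit) (q : N.RightUnit) : 0 ≤ φ.spread p q :=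
  div_nonneg (φ.across_nonneg _ _) (by positivity)

/-- Zero-capacity nodes carry no flow, so division by zero does no harm. -/
theorem Flow.sum_spread_right (φ : N.Flow) (p : N.LeftUnit) :
    ∑ q, φ.spread p q = φ.fromSource p.1 / N.leftCap p.1 := by
  rw [Fintype.sum_sigma, φ.conservation_left, Finset.sum_div]
  refine Finset.sum_congr rfl fun c _ => ?_
  simp only [spread, Finset.sum_const, Finset.card_univ, Fintype.card_fin, nsmul_eq_mul]
  rcases eq_or_ne (N.rightCap c) 0 with h | h
  · rw [φ.across_eq_zero_of_rightCap h]
    simp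
  · have : (N.rightCap c : ℝ) ≠ 0 := Nat.cast_ne_zero.mpr h
    field_simp

theorem Flow.sum_spread_left (φ : N.Flow) (q : N.RightUnit) :
    ∑ p, φ.spread p q = φ.toSink q.1 / N.rightCap q.1 := by
  rw [Fintype.sum_sigma, ← φ.conservation_right, Finset.sum_div]
  refine Finset.sum_congr rfl fun a _ => ?_
  simp only [spread, Finset.sum_const, Finset.card_univ, Fintype.card_fin, nsmul_eq_mul]
  rcases eq_or_ne (N.leftCap a) 0 with h | h
  · rw [φ.across_eq_zero_of_leftCap h]
    simp
  · have : (N.leftCap a : ℝ) ≠ 0 := Nat.cast_ne_zero.mpr h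
    field_simp

theorem Flow.sum_sum_spread (φ : N.Flow) (a : A) (c : B) :
    ∑ k : Fin (N.leftCap a), ∑ l : Fin (N.rightCap c), φ.spread ⟨a, k⟩ ⟨c, l⟩ = φ.across a c := by
  simp only [spread, Finset.sum_const, Finset.card_univ, Fintype.card_fin, nsmul_eq_mul]
  rcases eq_or_ne (N.leftCap a) 0 with h | h
  · rw [φ.across_eq_zero_of_leftCap h]
    simp
  rcases eq_or_ne (N.rightCap c) 0 with h' | h'
  · rw [φ.across_eq_zero_of_rightCap h']
    simp
  have : (N.leftCap a : ℝ) ≠ 0 := Nat.cast_ne_zero.mpr h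
  have : (N.rightCap c : ℝ) ≠ 0 := Nat.cast_ne_zero.mpr h'
  field_simp

open Classical in
/-- The doubly stochastic matrix of a flow. -/
noncomputable def Flow.stochasticMatrix (φ : N.Flow) :
    Matrix (N.LeftUnit ⊕ N.RightUnit) (N.LeftUnit ⊕ N.RightUnit) ℝ :=
  Matrix.fromBlocks (Matrix.diagonal fun p => 1 - ∑ q, φ.spread p q) (Matrix.of φ.spread)
    (Matrix.of φ.spread).transpose (Matrix.diagonal fun q => 1 - ∑ p, φ.spread p q)

open Classical in
-- The diagonal blocks hold the unused fraction of each unit copy, nonnegative by the capacity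
-- bounds; each row and column thus sums to 1.
theorem Flow.stochasticMatrix_mem (φ : N.Flow) :
    φ.stochasticMatrix ∈ doublyStochastic ℝ (N.LeftUnit ⊕ N.RightUnit) := by
  have hl : ∀ p, ∑ q, φ.spread p q ≤ 1 := fun p => by
    rw [φ.sum_spread_right]
    exact div_le_one_of_le₀ (φ.fromSource_le _) (Nat.cast_nonneg _)
  have hr : ∀ q, ∑ p, φ.spread p q ≤ 1 := fun q => by
    rw [φ.sum_spread_left]
    exact div_le_one_of_le₀ (φ.toSink_le _) (Nat.cast_nonneg _)
  rw [mem_doublyStochastic_iff_sum]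
  refine ⟨?_, ?_, ?_⟩
  · rintro (p | q) (p' | q')
    · simp only [stochasticMatrix, Matrix.fromBlocks_apply₁₁, Matrix.diagonal_apply]
      split_ifs
      · exact sub_nonneg.mpr (hl p)
      · exact le_rfl
    · exact φ.spread_nonneg _ _
    · exact φ.spread_nonneg _ _
    · simp only [stochasticMatrix, Matrix.fromBlocks_apply₂₂, Matrix.diagonal_apply]
      split_ifs
      · exact sub_nonneg.mpr (hr q)
      · exact le_rfl
  · rintro (p | q) <;> simp [stochasticMatrix, Fintype.sum_sum_type, Matrix.diagonal_apply]
  · rintro (p | q) <;> simp [stochasticMatrix, Fintype.sum_sum_type, Matrix.diagonal_apply]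

open Classical in
/-- The number of unit copies of `a` that a permutation sends to unit copies of `c`. -/
noncomputable def permFlow (N : BipartiteNetwork A B)
    (σ : Equiv.Perm (N.LeftUnit ⊕ N.RightUnit)) (a : A) (c : B) : ℕ :=
  ∑ k : Fin (N.leftCap a), ∑ l : Fin (N.rightCap c),
    if σ (Sum.inl ⟨a, k⟩) = Sum.inr ⟨c, l⟩ then 1 else 0

theorem sum_permFlow_right {A B : Type*} [Fintype B] {N : BipartiteNetwork A B}
    (σ : Equiv.Perm (N.LeftUnit ⊕ N.RightUnit)) (a : A) :
    ∑ c, N.permFlow σ a c ≤ N.leftCap a := by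
  classical
  unfold permFlow
  rw [Finset.sum_comm]
  calc _ ≤ ∑ k : Fin (N.leftCap a), 1 := Finset.sum_le_sum fun k _ => ?_
    _ = N.leftCap a := by simp
  rw [← Fintype.sum_sigma (f := fun q : N.RightUnit =>
    if σ (Sum.inl ⟨a, k⟩) = Sum.inr q then 1 else 0)]
  rcases σ (Sum.inl ⟨a, k⟩) with p | q <;> simp

theorem sum_permFlow_left {A B : Type*} [Fintype A] {N : BipartiteNetwork A B}
    (σ : Equiv.Perm (N.LeftUnit ⊕ N.RightUnit)) (c : B) :
    ∑ a, N.permFlow σ a c ≤ N.rightCap c := by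
  classical
  unfold permFlow
  simp_rw [Finset.sum_comm (s := (Finset.univ : Finset (Fin (N.leftCap _))))]
  rw [Finset.sum_comm]
  calc _ ≤ ∑ k : Fin (N.rightCap c), 1 := Finset.sum_le_sum fun l _ => ?_
    _ = N.rightCap c := by simp
  rw [← Fintype.sum_sigma (f := fun p : N.LeftUnit =>
    if σ (Sum.inl p) = Sum.inr ⟨c, l⟩ then 1 else 0)]
  simp_rw [← Equiv.eq_symm_apply]
  rcases σ.symm (Sum.inr ⟨c, l⟩) with p | q <;> simp

/-- Every flow is a convex combination of integral flows. -/
theorem Flow.exists_integral_combination (φ : N.Flow) :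
    ∃ (ι : Type (max u v)) (_ : Fintype ι) (w : ι → ℝ) (ψ : ι → N.Flow), (∀ i, 0 < w i) ∧
      ∑ i, w i = 1 ∧ (∀ i, (ψ i).IsIntegral) ∧
      ∀ a, φ.fromSource a = ∑ i, w i * (ψ i).fromSource a := by
  classical
  obtain ⟨w, hw0, hw1, hw⟩ := exists_eq_sum_perm_of_mem_doublyStochastic φ.stochasticMatrix_mem
  have hentry : ∀ p q, ∑ σ, w σ * (if σ (Sum.inl p) = Sum.inr q then 1 else 0) =
      φ.spread p q := fun p q => by
    have h := congrFun (congrFun hw (Sum.inl p)) (Sum.inr q)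
    simp only [Matrix.sum_apply, Matrix.smul_apply, Equiv.Perm.permMatrix, PEquiv.toMatrix_apply,
      Equiv.toPEquiv_apply, Option.mem_some_iff, smul_eq_mul] at h
    exact h
  have hacross : ∀ a c, ∑ σ, w σ * (N.permFlow σ a c : ℝ) = φ.across a c := fun a c => by
    rw [← φ.sum_sum_spread a c]
    simp_rw [← hentry, permFlow]
    push_cast
    simp_rw [Finset.mul_sum]
    rw [Finset.sum_comm]
    exact Finset.sum_congr rfl fun k _ => Finset.sum_comm
  -- A nonnegative average that vanishes has vanishing terms. Permutations of weight zero may use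
  -- forbidden arcs, which is why they are discarded below.
  have hzero : ∀ σ, 0 < w σ → ∀ a c, ¬ N.arc a c → N.permFlow σ a c = 0 := by
    intro σ hσ a c hac
    have h1 := hacross a c
    rw [φ.across_eq_zero a c hac, Finset.sum_eq_zero_iff_of_nonneg
      fun σ _ => mul_nonneg (hw0 σ) (Nat.cast_nonneg _)] at h1
    have h2 := (mul_eq_zero.mp (h1 σ (Finset.mem_univ σ))).resolve_left hσ.ne'
    exact_mod_cast h2
  have hsub : ∀ f : Equiv.Perm (N.LeftUnit ⊕ N.RightUnit) → ℝ,
      ∑ i : {σ // 0 < w σ}, w i * f i = ∑ σ, w σ * f σ := fun f => by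
    rw [← Fintype.sum_subtype_add_sum_subtype (fun σ => 0 < w σ) fun σ => w σ * f σ,
      Finset.sum_eq_zero (s := (Finset.univ : Finset {σ // ¬ 0 < w σ})), add_zero]
    intro σ _
    rw [le_antisymm (not_lt.mp σ.2) (hw0 σ), zero_mul]
  refine ⟨{σ // 0 < w σ}, inferInstance, fun σ => w σ,
    fun σ => Flow.ofNat (N.permFlow σ) (sum_permFlow_right _) (sum_permFlow_left _)
      (hzero σ σ.2), fun σ => σ.2, ?_, fun σ => Flow.isIntegral_ofNat _ _ _ _, fun a => ?_⟩
  · simpa [hw1] using hsub fun _ => 1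
  · refine Eq.trans ?_ (hsub fun σ => ((∑ c, N.permFlow σ a c : ℕ) : ℝ)).symm
    rw [φ.conservation_left]
    simp_rw [← hacross]
    push_cast
    simp_rw [Finset.mul_sum]
    exact Finset.sum_comm

/-- Every maximum flow is a convex combination of integral maximum flows. -/
theorem Flow.IsMaximum.exists_integral_combination {φ : N.Flow} (hφ : φ.IsMaximum) :
    ∃ (ι : Type (max u v)) (_ : Fintype ι) (w : ι → ℝ) (ψ : ι → N.Flow), (∀ i, 0 ≤ w i) ∧
      ∑ i, w i = 1 ∧ (∀ i, (ψ i).IsMaximum ∧ (ψ i).IsIntegral) ∧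
      ∀ a, φ.fromSource a = ∑ i, w i * (ψ i).fromSource a := by
  obtain ⟨ι, _, w, ψ, hw0, hw1, hint, hsum⟩ := φ.exists_integral_combination
  refine ⟨ι, ‹_›, w, ψ, fun i => (hw0 i).le, hw1, fun i => ⟨fun χ => (hφ χ).trans ?_, hint i⟩, hsum⟩
  have hval : φ.value = ∑ i, w i * (ψ i).value := by
    unfold Flow.value
    simp_rw [hsum, Finset.mul_sum]
    exact Finset.sum_comm
  -- A strictly positive weight on a non-maximum flow would pull the average below the maximum.
  by_contra! hlt
  have : ∑ i, w i * (ψ i).value < ∑ i, w i * φ.value :=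
    Finset.sum_lt_sum (fun i _ => mul_le_mul_of_nonneg_left (hφ _) (hw0 i).le)
      ⟨i, Finset.mem_univ i, mul_lt_mul_of_pos_left hlt (hw0 i)⟩
  rw [← hval, ← Finset.sum_mul, hw1, one_mul] at this
  exact lt_irrefl _ this

end Birkhoff

end BipartiteNetwork

/-! ### Sums over the right nodes. -/

section SumOver

theorem sum_dite_subtype {α M : Type*} [Fintype α] [AddCommMonoid M] (p : α → Prop)
    [DecidablePred p] [inst : Fintype {a // p a}] (f : {a // p a} → M) :
    ∑ a, (if h : p a then f ⟨a, h⟩ else 0) = ∑ a, f a := by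
  obtain rfl : inst = Subtype.fintype p := Subsingleton.elim _ _
  rw [← Fintype.sum_subtype_add_sum_subtype p,
    Finset.sum_eq_zero (s := (Finset.univ : Finset {a // ¬ p a})) fun a _ => dif_neg a.2, add_zero]
  exact Finset.sum_congr rfl fun a _ => dif_pos a.2

variable {V : Type*} [Fintype V] {G : SimpleGraph V} {b : V → ℕ}

theorem sum_rightNode {M : Type*} [AddCommMonoid M]
    [Fintype {i : V // i ∈ perfectlyDemanded G b ∪ overDemanded G b}]
    [Fintype {j : V // j ∈ overDemanded G b}]
    [Fintype {C : OddComponent G b // 2 ≤ (OddComponent.agents C).ncard}]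
    (f : RightNode G b → M) :
    ∑ c, f c = ∑ i, f (.own i) + ∑ j, f (.over j) + ∑ C, f (.comp C) := by
  let e : ({i : V // i ∈ perfectlyDemanded G b ∪ overDemanded G b} ⊕
      {j : V // j ∈ overDemanded G b}) ⊕
      {C : OddComponent G b // 2 ≤ (OddComponent.agents C).ncard} ≃ RightNode G b :=
    { toFun := Sum.elim (Sum.elim RightNode.own RightNode.over) RightNode.comp
      invFun := fun c => match c with
        | .own i => Sum.inl (Sum.inl i)
        | .over j => Sum.inl (Sum.inr j)
        | .comp C => Sum.inr C
      left_inv := by rintro ((i | j) | C) <;> rfl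
      right_inv := by rintro (i | j | C) <;> rfl }
  rw [← Fintype.sum_equiv e (fun c => f (e c)) f fun _ => rfl, Fintype.sum_sum_type,
    Fintype.sum_sum_type]
  rfl

end SumOver

/-! ### Translation between matchings and flows. -/

namespace BMatching

open BipartiteNetwork

variable {V : Type*} [Fintype V] {G : SimpleGraph V} {b : V → ℕ}

open Classical in
/-- The middle arcs of the flow of a matching. -/
noncomputable def flowAcross (μ : BMatching G b) (i : V) : RightNode G b → ℕ
  | .own j => if i = j.1 then b i else 0
  | .over j => if i ∈ underDemanded G b then μ.exch i j.1 else 0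
  | .comp C => if i ∈ OddComponent.agents C.1 then
      ∑ k with k ∈ OddComponent.agents C.1, μ.exch i k else 0

theorem flowAcross_eq_zero (μ : BMatching G b) (i : V) (c : RightNode G b)
    (h : ¬ (modifiedNetwork G b).arc i c) : μ.flowAcross i c = 0 := by
  rcases c with j | j | C
  · exact if_neg h
  · unfold flowAcross
    split_ifs with hi
    · exact μ.exch_eq_zero _ _ fun hadj => h ⟨hi, hadj⟩
    · rfl
  · exact if_neg h

/-- This is where the structure theorem enters: V^O is saturated by V^U alone, and each large
component trades one unit less than its peaks internally. -/
theorem sum_flowAcross_left {μ : BMatching G b} (hμ : μ.IsMaximum) (c : RightNode G b) :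
    ∑ i, μ.flowAcross i c = (modifiedNetwork G b).rightCap c := by
  classical
  rcases c with j | j | C
  · simp [flowAcross, modifiedNetwork]
  · change ∑ i, (if i ∈ underDemanded G b then μ.exch i j.1 else 0) = b j.1
    rw [← utility_eq_of_notMem hμ j.2.1]
    refine Finset.sum_congr rfl fun i _ => ?_
    rw [μ.exch_symm]
    split_ifs with hi
    · rfl
    · by_contra hne
      exact hi (mem_underDemanded_of_exch_pos hμ j.2 (Nat.pos_of_ne_zero (Ne.symm hne)))
  · change ∑ i, (if i ∈ OddComponent.agents C.1 then
      ∑ k with k ∈ OddComponent.agents C.1, μ.exch i k else 0) = OddComponent.peakSum C.1 - 1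
    rw [← Finset.sum_filter, ← sum_sum_exch_agents hμ C.2, Nat.add_sub_cancel]

theorem sum_flowAcross_right {μ : BMatching G b} (hμ : μ.IsMaximum) (i : V) :
    ∑ c, μ.flowAcross i c = μ.utility i := by
  classical
  let _ : Fintype {C : OddComponent G b // 2 ≤ (OddComponent.agents C).ncard} := Fintype.ofFinite _
  have hown : ∑ j : {j : V // j ∈ perfectlyDemanded G b ∪ overDemanded G b},
      μ.flowAcross i (.own j) = if i ∈ underDemanded G b then 0 else b i := by
    have h1 := sum_dite_subtype (fun j => j ∈ perfectlyDemanded G b ∪ overDemanded G b)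
      fun j => μ.flowAcross i (.own j)
    rw [← h1]
    have h2 : ∀ j, (if h : j ∈ perfectlyDemanded G b ∪ overDemanded G b then
        μ.flowAcross i (.own ⟨j, h⟩) else 0) =
          if i = j then (if i ∈ underDemanded G b then 0 else b i) else 0 := fun j => by
      by_cases hij : i = j
      · subst hij
        by_cases hi : i ∈ underDemanded G b <;> by_cases ho : i ∈ overDemanded G b <;>
          simp [flowAcross, perfectlyDemanded, hi, ho]
        exact absurd hi ho.1
      · simp [flowAcross, hij]
    refine (Finset.sum_congr rfl fun j _ => h2 j).trans ?_
    simp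
  rw [sum_rightNode, hown]
  by_cases hi : i ∈ underDemanded G b
  · rw [if_pos hi, zero_add]
    have hover : ∑ j : {j : V // j ∈ overDemanded G b}, μ.flowAcross i (.over j) =
        ∑ j with j ∈ overDemanded G b, μ.exch i j := by
      rw [Finset.sum_filter, ← sum_dite_subtype (fun j => j ∈ overDemanded G b)]
      refine Finset.sum_congr rfl fun j _ => ?_
      simp [flowAcross, hi]
    have hcomp : ∑ C : {C : OddComponent G b // 2 ≤ (OddComponent.agents C).ncard},
        μ.flowAcross i (.comp C) = ∑ j with j ∉ overDemanded G b, μ.exch i j := by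
      set C₀ : OddComponent G b :=
        (G.induce (underDemanded G b)).connectedComponentMk ⟨i, hi⟩ with hC₀
      have hiC : i ∈ OddComponent.agents C₀ := mem_agents_iff.mpr ⟨hi, rfl⟩
      have hmem : ∀ j, j ∉ overDemanded G b → μ.exch i j ≠ 0 → j ∈ OddComponent.agents C₀ := by
        intro j hj hne
        have hadj := μ.adj_of_exch_pos (Nat.pos_of_ne_zero hne)
        refine mem_agents_of_adj hiC ?_ hadj
        by_contra hjD
        exact hj ⟨hjD, i, hi, hadj.symm⟩
      have hsum : ∑ j with j ∈ OddComponent.agents C₀, μ.exch i j =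
          ∑ j with j ∉ overDemanded G b, μ.exch i j := by
        refine Finset.sum_subset (fun j hj => ?_) fun j hj hj' => ?_
        · have : j ∈ OddComponent.agents C₀ := by simpa using hj
          simpa using notMem_overDemanded (underDemanded_of_mem_agents this)
        · by_contra hne
          exact hj' (by simpa using hmem j (by simpa using hj) hne)
      rw [← hsum]
      have hne0 : ∀ C : {C : OddComponent G b // 2 ≤ (OddComponent.agents C).ncard},
          C.1 ≠ C₀ → μ.flowAcross i (.comp C) = 0 := fun C hC =>
        if_neg fun h => hC (eq_of_mem_agents h hiC)
      by_cases hbig : 2 ≤ (OddComponent.agents C₀).ncard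
      · rw [Fintype.sum_eq_single ⟨C₀, hbig⟩ fun C hC => hne0 C fun h => hC (Subtype.ext h)]
        exact if_pos hiC
      -- A singleton component has no right node, and its agent has no trade partner outside V^O.
      · rw [Finset.sum_eq_zero fun C _ => hne0 C fun h => hbig (h ▸ C.2), eq_comm]
        refine Finset.sum_eq_zero fun j hj => ?_
        by_contra hne
        have hjC : j ∈ OddComponent.agents C₀ := by simpa using hj
        have hij := (μ.adj_of_exch_pos (Nat.pos_of_ne_zero hne)).ne
        exact hbig ((Set.one_lt_ncard (Set.toFinite _)).mpr ⟨i, hiC, j, hjC, hij⟩)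
    rw [hover, hcomp]
    exact Finset.sum_filter_add_sum_filter_not _ _ _
  · have hover : ∀ j, μ.flowAcross i (.over j) = 0 := fun j => if_neg hi
    have hcomp : ∀ C, μ.flowAcross i (.comp C) = 0 := fun C =>
      if_neg fun h => hi (underDemanded_of_mem_agents h)
    simp [hover, hcomp, hi, utility_eq_of_notMem hμ hi]

/-- A maximum matching is the utility profile of an integral flow that fills all sink arcs. -/
theorem exists_flow {μ : BMatching G b} (hμ : μ.IsMaximum) :
    ∃ φ : (modifiedNetwork G b).Flow, φ.IsIntegral ∧ (∀ i, φ.fromSource i = μ.utility i) ∧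
      ∀ c, φ.toSink c = (modifiedNetwork G b).rightCap c :=
  ⟨Flow.ofNat μ.flowAcross (fun i => (sum_flowAcross_right hμ i).trans_le (μ.utility_le i))
      (fun c => (sum_flowAcross_left hμ c).le) μ.flowAcross_eq_zero,
    Flow.isIntegral_ofNat _ _ _ _, fun i => congrArg Nat.cast (sum_flowAcross_right hμ i),
    fun c => congrArg Nat.cast (sum_flowAcross_left hμ c)⟩

theorem isMaximum_of_toSink {A B : Type*} [Fintype A] [Fintype B] {N : BipartiteNetwork A B}
    {φ : N.Flow} (h : ∀ c, φ.toSink c = N.rightCap c) : φ.IsMaximum := fun ψ => by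
  rw [ψ.value_eq_sum_toSink, φ.value_eq_sum_toSink]
  exact Finset.sum_le_sum fun c _ => (ψ.toSink_le c).trans (h c).ge

variable (G b) in
-- The flow of any maximum matching fills all sink arcs, so the maximum value is the whole sink
-- capacity.
theorem toSink_of_isMaximum {φ : (modifiedNetwork G b).Flow} (hφ : φ.IsMaximum)
    (c : RightNode G b) : φ.toSink c = (modifiedNetwork G b).rightCap c := by
  obtain ⟨μ, hμ⟩ := exists_isMaximum G b
  obtain ⟨ψ, -, -, hψ⟩ := exists_flow hμ
  have h1 := hφ ψ
  rw [ψ.value_eq_sum_toSink, φ.value_eq_sum_toSink] at h1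
  simp_rw [hψ] at h1
  have h2 := le_antisymm (Finset.sum_le_sum fun c (_ : c ∈ Finset.univ) => φ.toSink_le c) h1
  exact (Finset.sum_eq_sum_iff_of_le fun c _ => φ.toSink_le c).mp h2 c (Finset.mem_univ c)

open Classical in
-- A profile below the peaks with total one less than theirs is the peaks minus one unit at some
-- `u`, which criticality at `u` realises.
theorem exists_core_of_sum {C : OddComponent G b} (hC : 2 ≤ (OddComponent.agents C).ncard)
    (f : V → ℕ) (hf : ∀ i, f i ≤ b i)
    (hsum : ∑ i with i ∈ OddComponent.agents C, f i = OddComponent.peakSum C - 1) :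
    ∃ ν : BMatching G (coreCap G b), ∀ i ∈ OddComponent.agents C, ν.utility i = f i := by
  have hodd := (odd_peakSum hC).pos
  obtain ⟨u, hu, hlt⟩ : ∃ u ∈ OddComponent.agents C, f u < b u := by
    by_contra! hcon
    have : OddComponent.peakSum C ≤ ∑ i with i ∈ OddComponent.agents C, f i :=
      Finset.sum_le_sum fun i hi => hcon i (by simpa using hi)
    omega
  have hle : ∀ i, f i + ind u i ≤ b i := fun i => by
    by_cases hi : i = u
    · subst hi
      rw [ind_self]
      omega
    · rw [ind_of_ne hi]
      exact hf i
  have heq : ∑ i with i ∈ OddComponent.agents C, (f i + ind u i) =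
      ∑ i with i ∈ OddComponent.agents C, b i := by
    have h3 : ∑ i with i ∈ OddComponent.agents C, ind u i = 1 := by
      simp [ind, hu]
    rw [Finset.sum_add_distrib, hsum, h3]
    exact Nat.sub_add_cancel hodd
  obtain ⟨ν, -, hν⟩ := exists_core_deficit hC hu
  refine ⟨ν, fun i hi => ?_⟩
  have h1 := hν i hi
  have h2 := (Finset.sum_eq_sum_iff_of_le fun i _ => hle i).mp heq i (by simpa using hi)
  omega

open Classical in
/-- The matching glued from a flow, a perfect matching on the perfectly demanded agents and
matchings on the odd components. -/
theorem exists_isMaximum_of_sums (x : V → RightNode G b → ℕ)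
    (h0 : ∀ i c, ¬ (modifiedNetwork G b).arc i c → x i c = 0) (hl : ∀ i, ∑ c, x i c ≤ b i)
    (hr : ∀ c, ∑ i, x i c = (modifiedNetwork G b).rightCap c) :
    ∃ μ : BMatching G b, ∀ i, μ.utility i = ∑ c, x i c := by
  let _ : Fintype {C : OddComponent G b // 2 ≤ (OddComponent.agents C).ncard} := Fintype.ofFinite _
  obtain ⟨ν₀, hν₀⟩ := exists_isMaximum G (coreCap G b)
  have hle : ∀ i c, x i c ≤ b i := fun i c =>
    (Finset.single_le_sum (fun _ _ => Nat.zero_le _) (Finset.mem_univ c)).trans (hl i)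
  have hcompsum : ∀ C : {C : OddComponent G b // 2 ≤ (OddComponent.agents C).ncard},
      ∑ i with i ∈ OddComponent.agents C.1, x i (.comp C) = OddComponent.peakSum C.1 - 1 :=
    fun C => by
      refine Eq.trans ?_ (hr (.comp C))
      refine Finset.sum_subset (Finset.subset_univ _) fun i _ hi => h0 _ _ fun h => hi ?_
      exact Finset.mem_filter.mpr ⟨Finset.mem_univ _, h⟩
  choose ν hν using fun C : {C : OddComponent G b // 2 ≤ (OddComponent.agents C).ncard} =>
    exists_core_of_sum C.2 (fun i => x i (.comp C)) (fun i => hle i _) (hcompsum C)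
  -- `o` holds the units sent to the nodes c'_j and is symmetrised when glued; `p` serves V^P and
  -- `q` the large components.
  let o : V → V → ℕ := fun i j => if h : j ∈ overDemanded G b then x i (.over ⟨j, h⟩) else 0
  let p : V → V → ℕ := fun i j =>
    if i ∈ perfectlyDemanded G b ∧ j ∈ perfectlyDemanded G b then ν₀.exch i j else 0
  let q : {C : OddComponent G b // 2 ≤ (OddComponent.agents C).ncard} → V → V → ℕ := fun C i j =>
    if i ∈ OddComponent.agents C.1 ∧ j ∈ OddComponent.agents C.1 then (ν C).exch i j else 0
  have hsum : ∀ i, ∑ j, (o i j + o j i + p i j + ∑ C, q C i j) = ∑ c, x i c := by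
    intro i
    have ho : ∑ j, o i j = ∑ j : {j : V // j ∈ overDemanded G b}, x i (.over j) :=
      sum_dite_subtype (fun j => j ∈ overDemanded G b) fun j => x i (.over j)
    have ho' : ∑ j, o j i = if i ∈ overDemanded G b then b i else 0 := by
      by_cases hi : i ∈ overDemanded G b
      · simp only [o, hi, dite_true, if_true]
        exact hr (.over ⟨i, hi⟩)
      · simp [o, hi]
    have hp : ∑ j, p i j = if i ∈ perfectlyDemanded G b then b i else 0 := by
      by_cases hi : i ∈ perfectlyDemanded G b
      · simp only [p, hi, true_and, if_true]
        rw [← core_utility_of_perfectlyDemanded hν₀ hi]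
        refine Finset.sum_congr rfl fun j _ => ?_
        split_ifs with hj
        · rfl
        · by_contra hne
          have hpos := Nat.pos_of_ne_zero (Ne.symm hne)
          have hadj := ν₀.adj_of_exch_pos hpos
          by_cases hjo : j ∈ overDemanded G b
          · rw [ν₀.core_exch_right hjo] at hpos
            exact lt_irrefl _ hpos
          -- An agent of V^P with a neighbour in V^U would belong to V^O.
          · refine hi.2 ⟨hi.1, j, ?_, hadj⟩
            by_contra hjD
            exact hj ⟨hjD, hjo⟩
      · simp [p, hi]
    have hq : ∀ C, ∑ j, q C i j = x i (.comp C) := fun C => by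
      by_cases hi : i ∈ OddComponent.agents C.1
      · simp only [q, hi, true_and]
        rw [← hν C i hi, ← (ν C).core_utility_agents hi, Finset.sum_filter]
      · simp only [q, hi, false_and, if_false, Finset.sum_const_zero]
        exact (h0 i (.comp C) hi).symm
    have hown : ∑ j : {j : V // j ∈ perfectlyDemanded G b ∪ overDemanded G b}, x i (.own j) =
        (if i ∈ overDemanded G b then b i else 0) +
          if i ∈ perfectlyDemanded G b then b i else 0 := by
      have h2 : ∀ j, (if h : j ∈ perfectlyDemanded G b ∪ overDemanded G b then
          x i (.own ⟨j, h⟩) else 0) = if i = j then ((if i ∈ overDemanded G b then b i else 0) +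
          if i ∈ perfectlyDemanded G b then b i else 0) else 0 := fun j => by
        by_cases hij : i = j
        · subst hij
          rw [if_pos rfl]
          by_cases hi : i ∈ perfectlyDemanded G b ∪ overDemanded G b
          · rw [dif_pos hi]
            have h3 : ∑ k, x k (.own ⟨i, hi⟩) = b i := hr (.own ⟨i, hi⟩)
            rw [Fintype.sum_eq_single i fun k hk => h0 k (.own ⟨i, hi⟩) hk] at h3
            rw [h3]
            by_cases hio : i ∈ overDemanded G b
            · simp [hio, perfectlyDemanded]
            · have hip := hi.resolve_right hio
              simp [hio, hip]
          · rw [dif_neg hi]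
            rw [Set.mem_union, not_or] at hi
            simp [hi.1, hi.2]
        · rw [if_neg hij]
          split_ifs
          · exact h0 _ _ hij
          · rfl
      rw [← sum_dite_subtype (fun j => j ∈ perfectlyDemanded G b ∪ overDemanded G b)]
      refine (Finset.sum_congr rfl fun j _ => h2 j).trans ?_
      simp
    -- The full arcs into the sink from the nodes c'_i give V^O its peaks and `p` gives V^P its
    -- peaks, which matches the flow into the nodes c_i.
    rw [sum_rightNode]
    simp only [Finset.sum_add_distrib]
    rw [Finset.sum_comm (f := fun j C => q C i j), Finset.sum_congr rfl fun C _ => hq C,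
      ho, ho', hp, hown]
    ring
  refine ⟨⟨fun i j => o i j + o j i + p i j + ∑ C, q C i j, fun i j => ?_, fun i j hij => ?_,
    fun i => (hsum i).trans_le (hl i)⟩, hsum⟩
  · have hp : p i j = p j i := by simp only [p, ν₀.exch_symm i j, and_comm]
    have hq : ∀ C, q C i j = q C j i := fun C => by
      simp only [q, (ν C).exch_symm i j, and_comm]
    simp_rw [hp, hq]
    ring
  · have ho : ∀ i j, ¬ G.Adj i j → o i j = 0 := fun i j hij => by
      simp only [o]
      split_ifs
      · exact h0 _ _ fun h => hij h.2
      · rfl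
    have hp : p i j = 0 := by simp only [p, ν₀.exch_eq_zero i j hij, ite_self]
    have hq : ∀ C, q C i j = 0 := fun C => by
      simp only [q, (ν C).exch_eq_zero i j hij, ite_self]
    simp [ho i j hij, ho j i fun h => hij h.symm, hp, hq]

/-- Integral maximum flows come from maximum matchings. -/
theorem exists_isMaximum_of_flow {φ : (modifiedNetwork G b).Flow} (hφ : φ.IsMaximum)
    (hint : φ.IsIntegral) :
    ∃ μ : BMatching G b, μ.IsMaximum ∧ ∀ i, (μ.utility i : ℝ) = φ.fromSource i := by
  have hnat : ∀ i c, ∃ n : ℕ, φ.across i c = n := fun i c => by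
    obtain ⟨n, hn⟩ := hint.2.1 i c
    have h0 : 0 ≤ n := by
      have := φ.across_nonneg i c
      rw [hn] at this
      exact_mod_cast this
    lift n to ℕ using h0
    exact ⟨n, by exact_mod_cast hn⟩
  choose x hx using hnat
  have hsrc : ∀ i, φ.fromSource i = (∑ c, x i c : ℕ) := fun i => by
    rw [φ.conservation_left]
    simp_rw [hx]
    push_cast
    rfl
  obtain ⟨ρ, hρ⟩ := exists_isMaximum_of_sums x
    (fun i c h => by
      have := φ.across_eq_zero i c h
      rw [hx] at this
      exact_mod_cast this)
    (fun i => by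
      have := φ.fromSource_le i
      rw [hsrc] at this
      exact Nat.cast_le.mp this)
    (fun c => by
      have := φ.conservation_right c
      rw [toSink_of_isMaximum G b hφ] at this
      simp_rw [hx] at this
      exact_mod_cast this)
  have hρφ : ∀ i, (ρ.utility i : ℝ) = φ.fromSource i := fun i => by rw [hρ, hsrc]
  refine ⟨ρ, ?_, hρφ⟩
  -- Comparing with the flow of a maximum matching shows that the glued matching has at least the
  -- maximum total.
  obtain ⟨μ, hμ⟩ := exists_isMaximum G b
  obtain ⟨ψ, -, hψ, -⟩ := exists_flow hμ
  refine hμ.of_total_le ?_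
  have h1 : ψ.value ≤ φ.value := hφ ψ
  unfold Flow.value at h1
  simp_rw [hψ, ← hρφ] at h1
  exact_mod_cast h1

end BMatching

/-! ### Both equivalences. -/

theorem mainTheorem3 {V : Type*} [Fintype V] (G : SimpleGraph V) (b : V → ℕ)
    (hb : ∀ i, 0 < b i) :
    (∀ U : V → ℝ,
      (∃ φ : (modifiedNetwork G b).Flow,
          φ.IsMaximum ∧ φ.IsIntegral ∧ ∀ i, φ.fromSource i = U i) ↔
        ∃ μ : BMatching G b, μ.IsMaximum ∧ ∀ i, (μ.utility i : ℝ) = U i) ∧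
    (∀ U : V → ℝ,
      (∃ φ : (modifiedNetwork G b).Flow, φ.IsMaximum ∧ ∀ i, φ.fromSource i = U i) ↔
        ∃ l : MatchingLottery G b, ∀ i, l.utility i = U i) := by
  classical
  refine ⟨fun U => ⟨?_, ?_⟩, fun U => ⟨?_, ?_⟩⟩
  · rintro ⟨φ, hφ, hint, hU⟩
    obtain ⟨μ, hμ, h⟩ := BMatching.exists_isMaximum_of_flow hφ hint
    exact ⟨μ, hμ, fun i => (h i).trans (hU i)⟩
  · rintro ⟨μ, hμ, hU⟩
    obtain ⟨φ, hint, hφ, hsink⟩ := BMatching.exists_flow hμ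
    exact ⟨φ, BMatching.isMaximum_of_toSink hsink, hint, fun i => (hφ i).trans (hU i)⟩
  · rintro ⟨φ, hφ, hU⟩
    obtain ⟨ι, _, w, ψ, hw0, hw1, hψ, hsum⟩ := hφ.exists_integral_combination
    choose μ hμ hμψ using fun k => BMatching.exists_isMaximum_of_flow (hψ k).1 (hψ k).2
    -- The matchings `μ k` may coincide, so their weights are added up by linearity.
    have hfs : ∀ g : BMatching G b → ℝ,
        ((∑ k, Finsupp.single (μ k) (w k)).sum fun ρ r => r * g ρ) = ∑ k, w k * g (μ k) := by
      intro g
      rw [← Finsupp.sum_finsetSum_index (fun _ => zero_mul _) fun _ _ _ => add_mul _ _ _]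
      exact Finset.sum_congr rfl fun k _ => Finsupp.sum_single_index (zero_mul _)
    refine ⟨⟨∑ k, Finsupp.single (μ k) (w k), fun ρ => ?_, ?_, fun ρ hρ => ?_⟩, fun i => ?_⟩
    · rw [Finsupp.finsetSum_apply]
      refine Finset.sum_nonneg fun k _ => ?_
      rw [Finsupp.single_apply]
      split_ifs
      · exact hw0 k
      · exact le_rfl
    · simpa [hw1] using hfs fun _ => 1
    · obtain ⟨k, -, hk⟩ := Finset.mem_biUnion.mp (Finsupp.support_finsetSum hρ)
      rw [Finset.mem_singleton.mp (Finsupp.support_single_subset hk)]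
      exact hμ k
    · rw [← hU, hsum]
      simp_rw [← hμψ]
      exact hfs fun ρ => (ρ.utility i : ℝ)
  · rintro ⟨l, hl⟩
    have hflow : ∀ ρ : BMatching G b, ∃ φ : (modifiedNetwork G b).Flow, ρ ∈ l.prob.support →
        (∀ i, φ.fromSource i = ρ.utility i) ∧
          ∀ c, φ.toSink c = (modifiedNetwork G b).rightCap c := by
      intro ρ
      by_cases hρ : ρ ∈ l.prob.support
      · obtain ⟨φ, -, h1, h2⟩ := BMatching.exists_flow (l.isMaximum_of_mem_support ρ hρ)
        exact ⟨φ, fun _ => ⟨h1, h2⟩⟩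
      -- Outside the support any flow serves as a default.
      · obtain ⟨μ, hμ⟩ := BMatching.exists_isMaximum G b
        obtain ⟨φ, -⟩ := BMatching.exists_flow hμ
        exact ⟨φ, fun h => absurd h hρ⟩
    choose ψ hψ using hflow
    refine ⟨BipartiteNetwork.Flow.combination l.prob.support l.prob (fun ρ _ => l.prob_nonneg ρ)
      l.sum_prob ψ, BMatching.isMaximum_of_toSink fun c => ?_, fun i => ?_⟩
    · change ∑ ρ ∈ l.prob.support, l.prob ρ * (ψ ρ).toSink c = _
      rw [Finset.sum_congr rfl fun ρ hρ => by rw [(hψ ρ hρ).2 c], ← Finset.sum_mul]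
      have : ∑ ρ ∈ l.prob.support, l.prob ρ = 1 := l.sum_prob
      rw [this, one_mul]
    · rw [← hl]
      exact Finset.sum_congr rfl fun ρ hρ => by rw [(hψ ρ hρ).1 i]
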